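/- **Setting.** Let $(X_i,Y_i)_{i\ge 1}$ be i.i.d. in $\mathbb R^p\times\mathbb R$, with $X_1$ square integrable and $\Sigma=\operatorname{var}(X_1)$ invertible, and let $Z_i=\Sigma^{-1/2}(X_i-EX_1)$. A subspace of $\mathbb R^p$ is a dimension reduction subspace if it is spanned by the columns of a matrix $\beta$ with $P(Y_1\in A\mid X_1)=P(Y_1\in A\mid \beta^TX_1)$ a.s. for all Borel $A$. Assume that there is a unique dimension reduction subspace of minimal dimension (the central subspace); let $E_c$ be its image under $\Sigma^{1/2}$ and $d_0=\dim E_c$. Let $\nu$ be a probability measure on $[0,1]$, and put $A_\nu(f)=\int f(u)f(u)^T\,d\nu(u)$ for $f\in \ell^\infty([0,1])^{p\times q}$. Let $\hat\mu=\hat\mu_n\in \ell^\infty([0,1])^{p\times q}$ be a function of the sample $(Z_i,Y_i)_{i\le n}$, and $\hat\mu^*$ a bootstrap version, a function of the sample and of randomness independent of it (both with $\nu$-measurable paths). Consider three tests, with $(p\times p)$-matrices $\hat Q_k$ (functions of the sample), $\hat Q_k^*$ (functions of the sample and the bootstrap randomness) and $Q_k$, $k=1,2,3$: 1. $H_0: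 d_0=d$ against $H_1: d_0>d$. Here $\hat Q_1$, $Q_1$, $\hat Q_1^*$ are eigenprojectors associated with the $p-d$ smallest eigenvalues of $A_\nu(\hat\mu)$, $A_\nu(\mu)$, $A_\nu(\hat\mu_1^*)$ respectively. 2. $H_0:\eta\in E_c^\perp$ (every column of $\eta$ is orthogonal to $E_c$) against $H_1:\eta\notin E_c^\perp$, for a given matrix $\eta$ with $\eta^T\eta=I$. Here $\hat Q_2=Q_2=\hat Q_2^*=\eta\eta^T$. 3. The same hypotheses, where $(\beta,\eta)$ is an orthogonal matrix, $(\hat\beta,\hat\eta)$ is an orthogonal matrix depending on the sample, and $\hat\beta\hat\beta^T\to\beta\beta^T$ in probability. Here $\hat Q_3=\hat\eta\hat\eta^T$, $Q_3=\eta\eta^T$, and $\hat Q_3^*$ is any bootstrap version of $\hat Q_3$. With $\hat\mu_k^*=(I-\hat Q_k)\hat\mu+(\hat\mu^*-\hat\mu)$ and $|\cdot|_F$ the Frobenius norm, let $$\hat\Lambda_k=n\int|\hat Q_k\hat\mu(u)|_F^2\,d\nu(u),\qquad \hat\Lambda_k^*=n\int|\hat Q_k^*\hat\mu_k^*(u)|_F^2\,d\nu(u).$$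 For $\alpha\in(0,1)$ let $\hat q^*_k(1-\alpha)=\inf\{x: P(\hat\Lambda^*_k\le x\mid\text{sample})\ge 1-\alpha\}$; the test of nominal level $\alpha$ rejects $H_0$ when $\hat\Lambda_k>\hat q_k^*(1-\alpha)$. **Assumptions.** Weak convergence is in the sense of Hoffmann-Jørgensen; conditional weak convergence in probability means that the bounded Lipschitz distance between the conditional law and the limit law tends to $0$ in outer probability; probabilities of possibly non-measurable events are outer probabilities. * (A1) $\mu:[0,1]\to\mathbb R^{p\times q}$ is continuous and the columns of the matrices $\mu(u)$, $u\in[0,1]$, span $E_c$. * (A2) $n^{1/2}(\hat\mu-\mu,\hat Q_k-Q_k)$ converges weakly in $\ell^\infty([0,1])^{p\times q}\times\mathbb R^{p\times p}$ to $(w_\mu,w_Q)$. * (A3) Conditionally on the sample, $n^{1/2}(\hat\mu^*-\hat\mu,\hat Q_k^*-\hat Q_k)$ converges weakly in the same space to $(\tilde w_\mu,\tilde w_Q)$, in probability, and $(Q_k\tilde w_\mu,\tilde w_Q\mu)$ has the same law as $(Q_kw_\mu,w_Q\mu)$. **Proposition.** Assume (A1). For each of the three tests, if (A2) and (A3) hold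 for the corresponding $k$, then the test based on $\hat\Lambda_k$ with quantiles computed from $\hat\Lambda_k^*$ is consistent, in the following sense. * Under $H_0$, $\hat\Lambda_k$ converges weakly to $W_k=\int|Q_kw_\mu(u)+w_Q\mu(u)|_F^2\,d\nu(u)$; conditionally on the sample, $\hat\Lambda_k^*$ converges weakly to $W_k$, in probability; and $P(\hat\Lambda_k>\hat q^*_k(1-\alpha))\to\alpha$ for every $\alpha\in(0,1)$ such that no $(1-\alpha)$-quantile of $W_k$ is an atom of the law of $W_k$ (in particular for every $\alpha\in(0,1)$ if the law of $W_k$ is continuous). * Under $H_1$, if moreover $\nu$ itself satisfies the coverage condition, i.e. the range of $A_\nu(\mu)$ is $E_c$, then $P(\hat\Lambda_k>\hat q^*_k(1-\alpha))\to1$ for every $\alpha\in(0,1)$. -/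

import Mathlib

open MeasureTheory ProbabilityTheory Filter Topology
open scoped ENNReal BoundedContinuousFunction Matrix

/- Matrices carry the Frobenius norm throughout. -/
attribute [local instance] Matrix.frobeniusNormedAddCommGroup Matrix.frobeniusNormedSpace

namespace InverseRegression

noncomputable section

/-! ### Weak convergence in the sense of Hoffmann-Jørgensen -/

/-- Outer expectation of a bounded, possibly non-measurable, function:
the infimum of `E U` over the integrable random variables `U ≥ T`. -/
def outerExp {Ω : Type*} [MeasurableSpace Ω] (P : Measure Ω) (T : Ω → ℝ) : ℝ :=
  sInf {r : ℝ | ∃ U : Ω → ℝ, Measurable U ∧ Integrable U P ∧ (∀ ω, T ω ≤ U ω) ∧ r = ∫ ω, U ω ∂P}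

/-- The (possibly non-measurable) maps `X n : Ω → D` converge weakly to the Borel random element
`w` of `D`: `E* f(X n) → E f(w)` for every bounded continuous `f`. -/
def WeakConv {Ω Ω₀ D : Type*} [MeasurableSpace Ω] [MeasurableSpace Ω₀] [PseudoMetricSpace D]
    (P : Measure Ω) (X : ℕ → Ω → D) (P₀ : Measure Ω₀) (w : Ω₀ → D) : Prop :=
  @AEMeasurable Ω₀ D (borel D) _ w P₀ ∧
    ∀ f : D →ᵇ ℝ, Tendsto (fun n => outerExp P (fun ω => f (X n ω))) atTop (𝓝 (∫ x, f (w x) ∂P₀))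

/-- The unit ball of the bounded Lipschitz functions on `D`. -/
def BL₁ (D : Type*) [PseudoMetricSpace D] : Set (D → ℝ) :=
  {h | (∀ x, |h x| ≤ 1) ∧ LipschitzWith 1 h}

/-- Conditional weak convergence in probability. `X n ω ω'` depends on the sample through `ω` and on
the independent bootstrap randomness through `ω'`; conditionally on the sample, its law is
that of `ω' ↦ X n ω ω'` under `P'`. The definition says that
`sup_{h ∈ BL₁} |E*' h(X n ω ·) - E h(w)| → 0` in outer `P`-probability
(a supremum exceeds `ε` iff some member of the family does; `P` of a set is its outer measure). -/
def CondWeakConv {Ω Ω' Ω₀ D : Type*} [MeasurableSpace Ω] [MeasurableSpace Ω'] [MeasurableSpace Ω₀]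
    [PseudoMetricSpace D] (P : Measure Ω) (P' : Measure Ω') (X : ℕ → Ω → Ω' → D)
    (P₀ : Measure Ω₀) (w : Ω₀ → D) : Prop :=
  @AEMeasurable Ω₀ D (borel D) _ w P₀ ∧
    ∀ ε : ℝ, 0 < ε → Tendsto (fun n => P {ω | ∃ h ∈ BL₁ D,
      ε < |outerExp P' (fun ω' => h (X n ω ω')) - ∫ x, h (w x) ∂P₀|}) atTop (𝓝 0)

/-! ### Central subspace -/

/-- `V` is spanned by the columns of some `β` with `P(Y ∈ A | X) = P(Y ∈ A | βᵀ X)` for every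
Borel set `A`. -/
def IsDimReduction {Ω : Type*} [MeasurableSpace Ω] {p : ℕ} (P : Measure Ω) (X : Ω → Fin p → ℝ)
    (Y : Ω → ℝ) (V : Submodule ℝ (Fin p → ℝ)) : Prop :=
  ∃ (d : ℕ) (β : Matrix (Fin p) (Fin d) ℝ),
    V = Submodule.span ℝ (Set.range fun j i => β i j) ∧
    ∀ A : Set ℝ, MeasurableSet A →
      P[(Y ⁻¹' A).indicator (fun _ => (1 : ℝ)) | MeasurableSpace.comap X inferInstance] =ᵐ[P]
      P[(Y ⁻¹' A).indicator (fun _ => (1 : ℝ)) |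
        MeasurableSpace.comap (fun ω => βᵀ *ᵥ X ω) inferInstance]

/-- `V` is the unique dimension reduction subspace of smallest dimension. -/
def IsCentralSubspace {Ω : Type*} [MeasurableSpace Ω] {p : ℕ} (P : Measure Ω)
    (X : Ω → Fin p → ℝ) (Y : Ω → ℝ) (V : Submodule ℝ (Fin p → ℝ)) : Prop :=
  IsDimReduction P X Y V ∧ ∀ V', IsDimReduction P X Y V' →
    Module.finrank ℝ V' ≤ Module.finrank ℝ V → V' = V

/-- The covariance matrix of `X`. -/
def covMatrix {Ω : Type*} [MeasurableSpace Ω] {p : ℕ} (P : Measure Ω) (X : Ω → Fin p → ℝ) :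
    Matrix (Fin p) (Fin p) ℝ :=
  fun k l => cov[fun ω => X ω k, fun ω => X ω l; P]

/-- The standardized predictor `Z = S⁻¹ (X - E X)`; `S` is the square root of `var X`. -/
def standardize {Ω : Type*} [MeasurableSpace Ω] {p : ℕ} (P : Measure Ω) (X : Ω → Fin p → ℝ)
    (S : Matrix (Fin p) (Fin p) ℝ) (x : Fin p → ℝ) : Fin p → ℝ :=
  S⁻¹ *ᵥ (x - fun k => ∫ ω, X ω k ∂P)

/-- Values of a sample `(Zᵢ, Yᵢ)`, `i < n`. -/
abbrev Data (p n : ℕ) : Type := Fin n → (Fin p → ℝ) × ℝ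

/-- The observed sample `(Zᵢ, Yᵢ)`, `i < n`, of standardized predictors and responses. -/
def sample {Ω : Type*} [MeasurableSpace Ω] {p : ℕ} (P : Measure Ω) (X : ℕ → Ω → Fin p → ℝ)
    (Y : ℕ → Ω → ℝ) (S : Matrix (Fin p) (Fin p) ℝ) (n : ℕ) (ω : Ω) : Data p n :=
  fun i => (standardize P (X 0) S (X i ω), Y i ω)

/-! ### Matrix-valued processes -/

/-- `l^∞([0,1])^{(p×q)}`, with the supremum (over `[0,1]`) of the Frobenius norm. -/
abbrev LInf (p q : ℕ) : Type :=
  lp (fun _ : unitInterval => Matrix (Fin p) (Fin q) ℝ) ∞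

/-- The process `u ↦ Q f(u)`. -/
def leftMul {p q : ℕ} (Q : Matrix (Fin p) (Fin p) ℝ) (f : LInf p q) : LInf p q :=
  ⟨fun u => Q * f u, by
    have hf := memℓp_infty_iff.1 (lp.memℓp f)
    obtain ⟨C, hC⟩ := hf
    refine memℓp_infty_iff.2 ⟨‖Q‖ * C, ?_⟩
    rintro _ ⟨u, rfl⟩
    exact (Matrix.frobenius_norm_mul Q (f u)).trans
      (mul_le_mul_of_nonneg_left (hC ⟨u, rfl⟩) (norm_nonneg Q))⟩

/-- The pair of processes `(Q w_μ, w_Q μ)` attached to `w = (w_μ, w_Q)`. -/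
def projPair {p q : ℕ} (Q : Matrix (Fin p) (Fin p) ℝ) (μ : LInf p q)
    (w : LInf p q × Matrix (Fin p) (Fin p) ℝ) : LInf p q × LInf p q :=
  (leftMul Q w.1, leftMul w.2 μ)

/-- The paths are measurable for the completion of `ν`, so that their integrals make sense. -/
def PathMeasurable {p q : ℕ} (ν : Measure unitInterval) (f : LInf p q) : Prop :=
  ∀ i j, AEMeasurable (fun u => f u i j) ν

/-- The span of the columns of all the matrices `μ(u)`, `u ∈ [0,1]`. -/
def pathSpan {p q : ℕ} (μ : LInf p q) : Submodule ℝ (Fin p → ℝ) :=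
  Submodule.span ℝ {v | ∃ (u : unitInterval) (j : Fin q), v = fun i => μ u i j}

/-- `A_ν(f) = ∫ f(u) f(u)ᵀ dν(u)`. -/
def gram {p q : ℕ} (ν : Measure unitInterval) (f : LInf p q) : Matrix (Fin p) (Fin p) ℝ :=
  fun i k => ∫ u, (f u * (f u)ᵀ) i k ∂ν

/-- `Q` is an eigenprojector of `A` associated with its `p - d` smallest eigenvalues, counted with
multiplicity: in an orthonormal eigenbasis (the columns of `U`) whose eigenvalues are arranged
in decreasing order, `Q` is the projector on the span of all but the first `d` vectors. -/
def IsLowEigenprojector {p : ℕ} (A : Matrix (Fin p) (Fin p) ℝ) (d : ℕ)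
    (Q : Matrix (Fin p) (Fin p) ℝ) : Prop :=
  ∃ U ∈ Matrix.orthogonalGroup (Fin p) ℝ, ∃ l : Fin p → ℝ, Antitone l ∧
    A = U * Matrix.diagonal l * Uᵀ ∧
    Q = U * Matrix.diagonal (fun k : Fin p => if d ≤ (k : ℕ) then (1 : ℝ) else 0) * Uᵀ

/-- The matrix `(β, η)` is an orthogonal matrix. -/
def IsOrthogonalPair {p d r : ℕ} (β : Matrix (Fin p) (Fin d) ℝ) (η : Matrix (Fin p) (Fin r) ℝ) :
    Prop :=
  (Matrix.fromCols β η)ᵀ * Matrix.fromCols β η = 1 ∧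
    Matrix.fromCols β η * (Matrix.fromCols β η)ᵀ = 1

/-- All the columns of `η` are orthogonal to `E`. -/
def ColsOrthogonalTo {p r : ℕ} (η : Matrix (Fin p) (Fin r) ℝ) (E : Submodule ℝ (Fin p → ℝ)) :
    Prop :=
  ∀ v ∈ E, ∀ j, (fun i => η i j) ⬝ᵥ v = 0

/-! ### The statistics -/

/-- The Cramér-von Mises statistic `n ∫ |Q f(u)|_F² dν(u)`. -/
def cvm {p q : ℕ} (ν : Measure unitInterval) (n : ℕ) (Q : Matrix (Fin p) (Fin p) ℝ)
    (f : LInf p q) : ℝ :=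
  n * ∫ u, ‖Q * f u‖ ^ 2 ∂ν

/-- The constrained bootstrap process `(I - Q̂) μ̂ + (μ̂* - μ̂)`. -/
def constrained {p q : ℕ} (Qhat : Matrix (Fin p) (Fin p) ℝ) (muHat muStar : LInf p q) :
    LInf p q :=
  leftMul (1 - Qhat) muHat + (muStar - muHat)

/-- The limit variable `∫ |Q w_μ(u) + w_Q μ(u)|_F² dν(u)` of the statistics. -/
def limitStat {p q : ℕ} (ν : Measure unitInterval) (Q : Matrix (Fin p) (Fin p) ℝ) (μ : LInf p q)
    (w : LInf p q × Matrix (Fin p) (Fin p) ℝ) : ℝ :=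
  ∫ u, ‖Q * w.1 u + w.2 * μ u‖ ^ 2 ∂ν

/-! ### The assumptions on the estimators and on their bootstrap versions -/

/-- `√n (μ̂ - μ, Q̂ - Q)` converges weakly to `(w_μ, w_Q)` in `l^∞([0,1])^{(p×q)} × ℝ^{p×p}`. -/
def JointWeakLimit {Ω Ω₀ : Type*} [MeasurableSpace Ω] [MeasurableSpace Ω₀] {p q : ℕ}
    (P : Measure Ω) (data : (n : ℕ) → Ω → Data p n)
    (muHat : (n : ℕ) → Data p n → LInf p q) (μ : LInf p q)
    (Qhat : (n : ℕ) → Data p n → Matrix (Fin p) (Fin p) ℝ) (Q : Matrix (Fin p) (Fin p) ℝ)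
    (P₀ : Measure Ω₀) (w : Ω₀ → LInf p q × Matrix (Fin p) (Fin p) ℝ) : Prop :=
  WeakConv P (fun n ω => Real.sqrt n • (muHat n (data n ω) - μ, Qhat n (data n ω) - Q)) P₀ w

/-- Conditionally on the sample, `√n (μ̂* - μ̂, Q̂* - Q̂)` converges weakly to `(w̃_μ, w̃_Q)`, in
probability, and `(Q w̃_μ, w̃_Q μ)` has the same (Borel) law as `(Q w_μ, w_Q μ)`. -/
def BootstrapWeakLimit {Ω Ω' Ω₀ Ω₁ : Type*} [MeasurableSpace Ω] [MeasurableSpace Ω']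
    [MeasurableSpace Ω₀] [MeasurableSpace Ω₁] {p q : ℕ}
    (P : Measure Ω) (P' : Measure Ω') (data : (n : ℕ) → Ω → Data p n)
    (muHat : (n : ℕ) → Data p n → LInf p q) (muStar : (n : ℕ) → Data p n → Ω' → LInf p q)
    (μ : LInf p q)
    (Qhat : (n : ℕ) → Data p n → Matrix (Fin p) (Fin p) ℝ)
    (Qstar : (n : ℕ) → Data p n → Ω' → Matrix (Fin p) (Fin p) ℝ)
    (Q : Matrix (Fin p) (Fin p) ℝ)
    (P₀ : Measure Ω₀) (w : Ω₀ → LInf p q × Matrix (Fin p) (Fin p) ℝ)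
    (P₁ : Measure Ω₁) (w' : Ω₁ → LInf p q × Matrix (Fin p) (Fin p) ℝ) : Prop :=
  CondWeakConv P P' (fun n ω ω' => Real.sqrt n •
      (muStar n (data n ω) ω' - muHat n (data n ω), Qstar n (data n ω) ω' - Qhat n (data n ω)))
    P₁ w' ∧
  @IdentDistrib Ω₁ Ω₀ (LInf p q × LInf p q) _ _ (borel _)
    (fun x => projPair Q μ (w' x)) (fun x => projPair Q μ (w x)) P₁ P₀

/-! ### Consistency of a bootstrap test -/

/-- The quantile of order `γ` of the statistic `T` under the bootstrap distribution `P'`. -/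
def bootQuantile {Ω' : Type*} [MeasurableSpace Ω'] (P' : Measure Ω') (T : Ω' → ℝ) (γ : ℝ) : ℝ :=
  sInf {x : ℝ | γ ≤ P'.real {ω' | T ω' ≤ x}}

/-- Probability that the test of nominal level `α` rejects, i.e. that `T` exceeds the bootstrap
quantile of order `1 - α` computed from `Tstar` conditionally on the sample. -/
def rejectProb {Ω Ω' : Type*} [MeasurableSpace Ω] [MeasurableSpace Ω'] (P : Measure Ω)
    (P' : Measure Ω') (T : Ω → ℝ) (Tstar : Ω → Ω' → ℝ) (α : ℝ) : ℝ :=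
  P.real {ω | bootQuantile P' (Tstar ω) (1 - α) < T ω}

/-- No quantile of order `γ` of the random variable `W` is an atom of its law. -/
def NoAtomAtQuantile {Ω₀ : Type*} [MeasurableSpace Ω₀] (P₀ : Measure Ω₀) (W : Ω₀ → ℝ) (γ : ℝ) :
    Prop :=
  ∀ x : ℝ, P₀.real {a | W a < x} ≤ γ → γ ≤ P₀.real {a | W a ≤ x} → P₀ {a | W a = x} = 0

/-- Behaviour of the test under the null hypothesis: the statistic converges weakly to `W`, the
bootstrap statistic has the same weak limit conditionally on the sample, in probability, and the
level converges to the nominal level `α`, for every `α ∈ (0,1)` such that no `(1-α)`-quantile of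
`W` is an atom of its law. -/
def ConsistentLevel {Ω Ω' Ω₀ : Type*} [MeasurableSpace Ω] [MeasurableSpace Ω']
    [MeasurableSpace Ω₀] (P : Measure Ω) (P' : Measure Ω') (T : ℕ → Ω → ℝ)
    (Tstar : ℕ → Ω → Ω' → ℝ) (P₀ : Measure Ω₀) (W : Ω₀ → ℝ) : Prop :=
  WeakConv P T P₀ W ∧ CondWeakConv P P' Tstar P₀ W ∧
    ∀ α : ℝ, 0 < α → α < 1 → NoAtomAtQuantile P₀ W (1 - α) →
      Tendsto (fun n => rejectProb P P' (T n) (Tstar n) α) atTop (𝓝 α)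

/-- Behaviour of the test under the alternative: the power goes to one at every nominal level. -/
def ConsistentPower {Ω Ω' : Type*} [MeasurableSpace Ω] [MeasurableSpace Ω'] (P : Measure Ω)
    (P' : Measure Ω') (T : ℕ → Ω → ℝ) (Tstar : ℕ → Ω → Ω' → ℝ) : Prop :=
  ∀ α : ℝ, 0 < α → α < 1 →
    Tendsto (fun n => rejectProb P P' (T n) (Tstar n) α) atTop (𝓝 1)

end

end InverseRegression

/-!
All three tests reject for large values of `n ∫ |Q̂ μ̂|² dν`, where `Q̂` is idempotent and
estimates a matrix `Q`. The argument is the same for all of them and depends on the test only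
through the dichotomy `Q μ = 0` or `Q μ ≠ 0` in `L²(ν)`.

Write `x = √n (μ̂ - μ, Q̂ - Q) = (a, b)` and `y = √n (μ̂* - μ̂, Q̂* - Q̂) = (a', b')`.

* If `Q μ = 0`, then `√n Q̂ μ̂ = Q a + b μ + n^{-1/2} b a` (`leftMul_expansion`), a continuous
  function of `x` up to a term that vanishes uniformly on bounded sets. The statistic converges
  by the continuous mapping theorem (`weakConv_cvm`).
* Since `Q̂ (I - Q̂) = 0`, the term of order `√n` of the constrained bootstrap process cancels:
  `√n Q̂* μ̂*_k = Q a' + b' (I - Q) μ + o(1)` (`constrained_expansion`). Thus the bootstrap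
  statistic has a conditional weak limit under the null hypothesis and under the alternative
  (`condWeakConv_cvm`). If `Q μ = 0`, then `(I - Q) μ = μ` and this limit has the law of the
  limit of the statistic.
* If `Q μ ≠ 0`, then the statistic is of order `n` (`tendsto_measure_cvm_le`), whereas the
  bootstrap quantiles are bounded in probability.

The continuous mapping theorems `WeakConv.map_of_close` and `CondWeakConv.map_of_close` are
proved directly for outer expectations of non-measurable maps into a normed space that need not
be separable: only monotonicity and the addition of constants are used for outer expectations,
and test functions are localized with a Lipschitz cutoff of the norm. The squared `L²(ν)` norm
is extended from the `ν`-measurable paths to the whole of `l^∞` as a lower integral,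
`lowerSqNorm`, which is locally Lipschitz; the limit process has `ν`-measurable paths almost
surely because these form a closed set (`JointWeakLimit.ae_pathMeasurable`).

The passage from weak convergence to level and power (`tendsto_rejectProb_null`,
`tendsto_rejectProb_one`) compares tail probabilities with expectations of piecewise linear
functions. Finally, linear algebra of the matrix `A_ν(μ) = ∫ μ μᵀ dν` decides which hypothesis
holds: `Q μ = 0` in `L²(ν)` if and only if `Q A_ν(μ) = 0`, the range of `A_ν(μ)` is contained in
the span of the columns of `μ`, and under the coverage condition the two are equal.
-/

namespace InverseRegression

/-! ### Outer expectations -/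

section OuterExp

variable {Ω : Type*} [MeasurableSpace Ω] {P : Measure Ω} [IsProbabilityMeasure P]

lemma outerExp_bddBelow {T : Ω → ℝ} {c : ℝ} (hT : ∀ ω, c ≤ T ω) :
    BddBelow {r : ℝ | ∃ U : Ω → ℝ, Measurable U ∧ Integrable U P ∧ (∀ ω, T ω ≤ U ω) ∧
      r = ∫ ω, U ω ∂P} := by
  refine ⟨c, ?_⟩
  rintro _ ⟨U, -, hUi, hTU, rfl⟩
  calc c = ∫ _, c ∂P := by simp
    _ ≤ ∫ ω, U ω ∂P := integral_mono (integrable_const c) hUi fun ω => (hT ω).trans (hTU ω)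

lemma outerExp_nonempty {T : Ω → ℝ} {C : ℝ} (hT : ∀ ω, T ω ≤ C) :
    {r : ℝ | ∃ U : Ω → ℝ, Measurable U ∧ Integrable U P ∧ (∀ ω, T ω ≤ U ω) ∧
      r = ∫ ω, U ω ∂P}.Nonempty :=
  ⟨_, fun _ => C, measurable_const, integrable_const C, hT, rfl⟩

lemma outerExp_mono {T T' : Ω → ℝ} {c C : ℝ} (hc : ∀ ω, c ≤ T ω) (hC : ∀ ω, T' ω ≤ C)
    (h : ∀ ω, T ω ≤ T' ω) : outerExp P T ≤ outerExp P T' := by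
  refine csInf_le_csInf (outerExp_bddBelow hc) (outerExp_nonempty hC) ?_
  rintro r ⟨U, h1, h2, h3, h4⟩
  exact ⟨U, h1, h2, fun ω => (h ω).trans (h3 ω), h4⟩

lemma le_outerExp {T : Ω → ℝ} {c C : ℝ} (hT : ∀ ω, T ω ≤ C)
    (h : ∀ U : Ω → ℝ, Measurable U → Integrable U P → (∀ ω, T ω ≤ U ω) → c ≤ ∫ ω, U ω ∂P) :
    c ≤ outerExp P T := by
  refine le_csInf (outerExp_nonempty hT) ?_
  rintro _ ⟨U, h1, h2, h3, rfl⟩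
  exact h U h1 h2 h3

lemma outerExp_le {T U : Ω → ℝ} {c : ℝ} (hc : ∀ ω, c ≤ T ω) (h1 : Measurable U)
    (h2 : Integrable U P) (h3 : ∀ ω, T ω ≤ U ω) : outerExp P T ≤ ∫ ω, U ω ∂P :=
  csInf_le (outerExp_bddBelow hc) ⟨U, h1, h2, h3, rfl⟩

lemma outerExp_const (c : ℝ) : outerExp P (fun _ => c) = c := by
  refine le_antisymm ?_ ?_
  · simpa using outerExp_le (P := P) (T := fun _ => c) (U := fun _ => c) (fun _ => le_rfl)
      measurable_const (integrable_const c) (fun _ => le_rfl)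
  · refine le_outerExp (C := c) (fun _ => le_rfl) fun U _ hU h => ?_
    calc c = ∫ _, c ∂P := by simp
      _ ≤ ∫ ω, U ω ∂P := integral_mono (integrable_const c) hU h

lemma outerExp_add_const_le {T : Ω → ℝ} {C : ℝ} (hT : ∀ ω, |T ω| ≤ C) (c : ℝ) :
    outerExp P (fun ω => T ω + c) ≤ outerExp P T + c := by
  rw [← sub_le_iff_le_add]
  refine le_outerExp (fun ω => (abs_le.1 (hT ω)).2) fun U h1 h2 h3 => ?_
  rw [sub_le_iff_le_add]
  have := outerExp_le (P := P) (T := fun ω => T ω + c) (U := fun ω => U ω + c) (c := -C + c)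
    (fun ω => by linarith [(abs_le.1 (hT ω)).1]) (h1.add_const c) (h2.add (integrable_const c))
    (fun ω => by linarith [h3 ω])
  rwa [integral_add h2 (integrable_const c), integral_const, probReal_univ, one_smul] at this

lemma outerExp_const_mul_le {T : Ω → ℝ} {C : ℝ} (hT : ∀ ω, |T ω| ≤ C) {c : ℝ} (hc : 0 < c) :
    outerExp P (fun ω => c * T ω) ≤ c * outerExp P T := by
  rw [← inv_mul_le_iff₀ hc]
  refine le_outerExp (fun ω => (abs_le.1 (hT ω)).2) fun U h1 h2 h3 => ?_
  rw [inv_mul_le_iff₀ hc, ← integral_const_mul]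
  exact outerExp_le (c := c * -C) (fun ω => mul_le_mul_of_nonneg_left (abs_le.1 (hT ω)).1 hc.le)
    (h1.const_mul c) (h2.const_mul c) fun ω => mul_le_mul_of_nonneg_left (h3 ω) hc.le

lemma outerExp_const_mul {T : Ω → ℝ} {C : ℝ} (hT : ∀ ω, |T ω| ≤ C) {c : ℝ} (hc : 0 < c) :
    outerExp P (fun ω => c * T ω) = c * outerExp P T := by
  refine le_antisymm (outerExp_const_mul_le hT hc) ?_
  have := outerExp_const_mul_le (P := P) (T := fun ω => c * T ω) (C := c * C)
    (fun ω => by rw [abs_mul, abs_of_pos hc]; exact mul_le_mul_of_nonneg_left (hT ω) hc.le)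
    (inv_pos.2 hc)
  simp only [inv_mul_cancel_left₀ hc.ne'] at this
  rwa [le_inv_mul_iff₀ hc] at this

/-- Markov's inequality for outer probabilities and outer expectations. -/
lemma measureReal_le_outerExp {A : Set Ω} {T : Ω → ℝ} {C : ℝ} (h0 : ∀ ω, 0 ≤ T ω)
    (hC : ∀ ω, T ω ≤ C) (hA : ∀ ω ∈ A, 1 ≤ T ω) : P.real A ≤ outerExp P T := by
  refine le_outerExp hC fun U h1 h2 h3 => ?_
  have h := mul_meas_ge_le_integral_of_nonneg (μ := P) (f := U)
    (Eventually.of_forall fun ω => (h0 ω).trans (h3 ω)) h2 1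
  rw [one_mul] at h
  exact (measureReal_mono fun ω hω => (hA ω hω).trans (h3 ω)).trans h

end OuterExp

/-! ### Cutoff functions -/

/-- The `1`-Lipschitz function of `‖x‖` that is `0` for `‖x‖ ≤ R` and `1` for `R + 1 ≤ ‖x‖`. -/
noncomputable def cutoff {D : Type*} [SeminormedAddCommGroup D] (R : ℝ) (x : D) : ℝ :=
  min 1 (max 0 (‖x‖ - R))

/-- The `k`-Lipschitz function on `ℝ` that is `0` on `(-∞, a]` and `1` on `[a + 1/k, ∞)`. -/
noncomputable def ramp (k a x : ℝ) : ℝ := min 1 (max 0 (k * (x - a)))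

section Cutoff

variable {D : Type*} [SeminormedAddCommGroup D]

lemma cutoff_nonneg (R : ℝ) (x : D) : 0 ≤ cutoff R x := le_min zero_le_one (le_max_left _ _)

lemma cutoff_le_one (R : ℝ) (x : D) : cutoff R x ≤ 1 := min_le_left _ _

lemma cutoff_eq_zero {R : ℝ} {x : D} (h : ‖x‖ ≤ R) : cutoff R x = 0 := by
  rw [cutoff, max_eq_left (by linarith), min_eq_right zero_le_one]

lemma cutoff_eq_one {R : ℝ} {x : D} (h : R + 1 ≤ ‖x‖) : cutoff R x = 1 :=
  min_eq_left (le_max_of_le_right (by linarith))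

lemma abs_min_max_sub_le (s t : ℝ) :
    |min 1 (max 0 s) - min 1 (max 0 t)| ≤ |s - t| := by
  have h1 := abs_min_sub_min_le_max 1 (max 0 s) 1 (max 0 t)
  have h2 := abs_max_sub_max_le_max 0 s 0 t
  simp only [sub_self, abs_zero] at h1 h2
  rw [max_eq_right (abs_nonneg (max 0 s - max 0 t))] at h1
  rw [max_eq_right (abs_nonneg (s - t))] at h2
  exact h1.trans h2

lemma abs_cutoff_sub_le (R : ℝ) (x y : D) : |cutoff R x - cutoff R y| ≤ ‖x - y‖ := by
  refine (abs_min_max_sub_le _ _).trans ?_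
  rw [sub_sub_sub_cancel_right]
  exact abs_norm_sub_norm_le x y

lemma continuous_cutoff (R : ℝ) : Continuous (cutoff R : D → ℝ) := by
  unfold cutoff; fun_prop

lemma ramp_nonneg (k a x : ℝ) : 0 ≤ ramp k a x := le_min zero_le_one (le_max_left _ _)

lemma ramp_le_one (k a x : ℝ) : ramp k a x ≤ 1 := min_le_left _ _

lemma ramp_eq_zero {k a x : ℝ} (hk : 0 ≤ k) (h : x ≤ a) : ramp k a x = 0 := by
  rw [ramp, max_eq_left (mul_nonpos_of_nonneg_of_nonpos hk (by linarith)),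
    min_eq_right zero_le_one]

lemma ramp_eq_one {a b x : ℝ} (hab : a < b) (h : b ≤ x) : ramp (b - a)⁻¹ a x = 1 := by
  refine min_eq_left (le_max_of_le_right ?_)
  rw [le_inv_mul_iff₀ (sub_pos.2 hab)]
  linarith

lemma abs_ramp_sub_le {k : ℝ} (hk : 0 ≤ k) (a x y : ℝ) :
    |ramp k a x - ramp k a y| ≤ k * |x - y| := by
  refine (abs_min_max_sub_le _ _).trans_eq ?_
  rw [← mul_sub, sub_sub_sub_cancel_right, abs_mul, abs_of_nonneg hk]

lemma continuous_ramp (k a : ℝ) : Continuous (ramp k a) := by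
  unfold ramp; fun_prop

end Cutoff

/-! ### Weak convergence, unconditional and conditional -/

section Weak

variable {Ω Ω' Ω₀ D : Type*} [MeasurableSpace Ω] [MeasurableSpace Ω'] [MeasurableSpace Ω₀]

lemma aemeasurable_comp_borel [TopologicalSpace D] {P₀ : Measure Ω₀} {w : Ω₀ → D}
    (hw : @AEMeasurable Ω₀ D (borel D) _ w P₀) {g : D → ℝ} (hg : Continuous g) :
    AEMeasurable (fun x => g (w x)) P₀ := by
  let _ : MeasurableSpace D := borel D
  have : BorelSpace D := ⟨rfl⟩
  exact hg.measurable.comp_aemeasurable hw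

lemma integrable_comp_borel [TopologicalSpace D] {P₀ : Measure Ω₀} [IsProbabilityMeasure P₀]
    {w : Ω₀ → D} (hw : @AEMeasurable Ω₀ D (borel D) _ w P₀) {g : D → ℝ} (hg : Continuous g)
    {C : ℝ} (hC : ∀ x, |g x| ≤ C) : Integrable (fun x => g (w x)) P₀ :=
  Integrable.of_bound (aemeasurable_comp_borel hw hg).aestronglyMeasurable C
    (Eventually.of_forall fun x => hC (w x))

variable {P : Measure Ω} {P' : Measure Ω'} {P₀ : Measure Ω₀}

lemma WeakConv.tendsto [PseudoMetricSpace D] {X : ℕ → Ω → D} {w : Ω₀ → D}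
    (h : WeakConv P X P₀ w) {g : D → ℝ} (hg : Continuous g) {C : ℝ} (hC : ∀ x, |g x| ≤ C) :
    Tendsto (fun n => outerExp P (fun ω => g (X n ω))) atTop (𝓝 (∫ x, g (w x) ∂P₀)) :=
  h.2 (BoundedContinuousFunction.ofNormedAddCommGroup g hg C hC)

/-- The supremum over bounded Lipschitz functions may be taken over a ball of any radius. -/
lemma CondWeakConv.tendsto_ball [IsProbabilityMeasure P'] [PseudoMetricSpace D]
    {X : ℕ → Ω → Ω' → D} {w : Ω₀ → D}
    (hX : CondWeakConv P P' X P₀ w) {K ε : ℝ} (hK : 0 < K) (hε : 0 < ε) :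
    Tendsto (fun n => P {ω | ∃ h : D → ℝ, (∀ x, |h x| ≤ K) ∧ (∀ x y, |h x - h y| ≤ K * dist x y) ∧
      ε < |outerExp P' (fun ω' => h (X n ω ω')) - ∫ x, h (w x) ∂P₀|}) atTop (𝓝 0) := by
  refine tendsto_of_tendsto_of_tendsto_of_le_of_le tendsto_const_nhds
    (hX.2 (K⁻¹ * ε) (by positivity)) (fun _ => zero_le) fun n => measure_mono ?_
  rintro ω ⟨h, h1, h2, h3⟩
  refine ⟨fun x => K⁻¹ * h x, ⟨fun x => ?_, LipschitzWith.of_dist_le_mul fun x y => ?_⟩, ?_⟩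
  · rw [abs_mul, abs_of_pos (inv_pos.2 hK), inv_mul_le_iff₀ hK, mul_one]
    exact h1 x
  · rw [Real.dist_eq, ← mul_sub, abs_mul, abs_of_pos (inv_pos.2 hK), inv_mul_le_iff₀ hK]
    simpa using h2 x y
  · rw [outerExp_const_mul (fun ω' => h1 (X n ω ω')) (inv_pos.2 hK), integral_const_mul, ← mul_sub,
      abs_mul, abs_of_pos (inv_pos.2 hK)]
    exact mul_lt_mul_of_pos_left h3 (inv_pos.2 hK)

variable [IsProbabilityMeasure P'] [IsProbabilityMeasure P₀]
  [SeminormedAddCommGroup D]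

/-- A Borel random element puts little mass outside large balls. -/
lemma exists_integral_cutoff_lt {w : Ω₀ → D} (hw : @AEMeasurable Ω₀ D (borel D) _ w P₀)
    {ε : ℝ} (hε : 0 < ε) : ∃ R : ℝ, 0 ≤ R ∧ ∫ x, cutoff R (w x) ∂P₀ < ε := by
  have h : Tendsto (fun R : ℝ => ∫ x, cutoff R (w x) ∂P₀) atTop (𝓝 (∫ _, (0 : ℝ) ∂P₀)) := by
    refine tendsto_integral_filter_of_dominated_convergence (fun _ => (1 : ℝ))
      (Eventually.of_forall fun R =>
        (aemeasurable_comp_borel hw (continuous_cutoff R)).aestronglyMeasurable)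
      (Eventually.of_forall fun R => Eventually.of_forall fun x => ?_) (integrable_const _)
      (Eventually.of_forall fun x => ?_)
    · rw [Real.norm_of_nonneg (cutoff_nonneg _ _)]; exact cutoff_le_one _ _
    · refine tendsto_const_nhds.congr' ?_
      filter_upwards [eventually_ge_atTop ‖w x‖] with R hR using (cutoff_eq_zero hR).symm
  rw [integral_zero] at h
  obtain ⟨R, h1, h2⟩ := ((h.eventually_lt_const hε).and (eventually_ge_atTop 0)).exists
  exact ⟨R, h2, h1⟩

lemma WeakConv.exists_bound [IsProbabilityMeasure P] {X : ℕ → Ω → D} {w : Ω₀ → D}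
    (h : WeakConv P X P₀ w)
    {ε : ℝ} (hε : 0 < ε) : ∃ R : ℝ, 0 < R ∧ ∀ᶠ n in atTop, P.real {ω | R < ‖X n ω‖} < ε := by
  obtain ⟨R, hR, hRε⟩ := exists_integral_cutoff_lt h.1 hε
  refine ⟨R + 1, by linarith, ?_⟩
  have ht := h.tendsto (continuous_cutoff R) (C := 1) fun x => by
    rw [abs_of_nonneg (cutoff_nonneg _ _)]; exact cutoff_le_one _ _
  filter_upwards [ht.eventually_lt_const hRε] with n hn
  exact (measureReal_le_outerExp (fun ω => cutoff_nonneg _ _) (fun ω => cutoff_le_one _ _)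
    fun ω hω => (cutoff_eq_one (le_of_lt hω)).ge).trans_lt hn

lemma CondWeakConv.exists_bound {X : ℕ → Ω → Ω' → D} {w : Ω₀ → D}
    (h : CondWeakConv P P' X P₀ w) {ε : ℝ} (hε : 0 < ε) :
    ∃ R : ℝ, Tendsto (fun n => P {ω | ε < P'.real {ω' | R < ‖X n ω ω'‖}}) atTop (𝓝 0) := by
  obtain ⟨R, hR, hRε⟩ := exists_integral_cutoff_lt h.1 (half_pos hε)
  refine ⟨R + 1, ?_⟩
  refine tendsto_of_tendsto_of_tendsto_of_le_of_le tendsto_const_nhds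
    (h.tendsto_ball one_pos (half_pos hε)) (fun _ => zero_le) fun n => measure_mono ?_
  intro ω hω
  refine ⟨cutoff R, fun x => ?_, fun x y => ?_, ?_⟩
  · rw [abs_of_nonneg (cutoff_nonneg _ _)]; exact cutoff_le_one _ _
  · rw [one_mul, dist_eq_norm]; exact abs_cutoff_sub_le R x y
  · have h1 : P'.real {ω' | R + 1 < ‖X n ω ω'‖} ≤ outerExp P' fun ω' => cutoff R (X n ω ω') :=
      measureReal_le_outerExp (fun ω => cutoff_nonneg _ _) (fun ω => cutoff_le_one _ _)
        fun ω hω => (cutoff_eq_one (le_of_lt hω)).ge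
    have h2 : ε < P'.real {ω' | R + 1 < ‖X n ω ω'‖} := hω
    exact lt_of_lt_of_le (by linarith) (le_abs_self _)

lemma continuous_of_lipschitz_on_balls {F : D → ℝ}
    (hF : ∀ R : ℝ, ∃ K : ℝ, 0 ≤ K ∧ ∀ x y, ‖x‖ ≤ R → ‖y‖ ≤ R → |F x - F y| ≤ K * ‖x - y‖) :
    Continuous F := by
  refine LocallyLipschitz.continuous fun x => ?_
  obtain ⟨K, hK, h⟩ := hF (‖x‖ + 1)
  refine ⟨K.toNNReal, Metric.closedBall 0 (‖x‖ + 1), ?_, ?_⟩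
  · exact Metric.closedBall_mem_nhds_of_mem (by simp)
  · refine LipschitzOnWith.of_dist_le_mul fun y hy z hz => ?_
    rw [Real.dist_eq, dist_eq_norm, Real.coe_toNNReal K hK]
    exact h y z (by simpa using hy) (by simpa using hz)

/-- Continuous mapping theorem with a perturbation that is uniformly negligible on balls. -/
lemma WeakConv.map_of_close [IsProbabilityMeasure P] {X : ℕ → Ω → D} {w : Ω₀ → D}
    (hX : WeakConv P X P₀ w) {F : D → ℝ}
    (hF : ∀ R : ℝ, ∃ K : ℝ, 0 ≤ K ∧ ∀ x y, ‖x‖ ≤ R → ‖y‖ ≤ R → |F x - F y| ≤ K * ‖x - y‖)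
    {T : ℕ → Ω → ℝ}
    (hT : ∀ R ε : ℝ, 0 < ε → ∀ᶠ n in atTop, ∀ ω, ‖X n ω‖ ≤ R → |T n ω - F (X n ω)| ≤ ε) :
    WeakConv P T P₀ (fun x => F (w x)) := by
  have hFc := continuous_of_lipschitz_on_balls hF
  refine ⟨aemeasurable_comp_borel hX.1 hFc, fun f => ?_⟩
  obtain ⟨M, hM0, hM⟩ : ∃ M : ℝ, 0 < M ∧ ∀ x, |f x| ≤ M :=
    ⟨‖f‖ + 1, by positivity, fun x => (f.norm_coe_le_norm x).trans (by linarith)⟩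
  rw [Metric.tendsto_atTop']
  intro ε hε
  obtain ⟨R, hR0, hR⟩ := exists_integral_cutoff_lt hX.1 (ε := ε / (8 * M)) (by positivity)
  obtain ⟨K, hK0, hK⟩ := hF (R + 1)
  -- on the ball of radius `R + 1` the functional `F` stays in a compact interval
  set C : ℝ := |F 0| + K * (R + 1) with hCdef
  have hFC : ∀ x : D, ‖x‖ ≤ R + 1 → |F x| ≤ C := fun x hx => by
    have h1 := hK x 0 hx (by rw [norm_zero]; linarith)
    rw [sub_zero] at h1
    have h2 := abs_sub_abs_le_abs_sub (F x) (F 0)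
    have h3 := mul_le_mul_of_nonneg_left hx hK0
    linarith
  have huc := (isCompact_Icc (a := -C - 1) (b := C + 1)).uniformContinuousOn_of_continuous
    f.continuous.continuousOn
  rw [Metric.uniformContinuousOn_iff] at huc
  obtain ⟨δ, hδ, hfδ⟩ := huc (ε / 8) (by positivity)
  have hclose : ∀ᶠ n in atTop, ∀ ω,
      |f (T n ω) - f (F (X n ω))| ≤ ε / 8 + 2 * M * cutoff R (X n ω) := by
    filter_upwards [hT (R + 1) (min (δ / 2) 1) (by positivity)] with n hn ω
    rcases le_total ‖X n ω‖ (R + 1) with hx | hx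
    · have h1 := hn ω hx
      have h2 := abs_le.1 (h1.trans (min_le_right _ _))
      have h3 := abs_le.1 (hFC _ hx)
      have h4 := hfδ (T n ω) ⟨by linarith, by linarith⟩ (F (X n ω)) ⟨by linarith, by linarith⟩
        (by rw [Real.dist_eq]; exact (h1.trans (min_le_left _ _)).trans_lt (by linarith))
      rw [Real.dist_eq] at h4
      have := mul_nonneg (by positivity : (0 : ℝ) ≤ 2 * M) (cutoff_nonneg R (X n ω))
      linarith
    · rw [cutoff_eq_one hx]
      have := abs_sub (f (T n ω)) (f (F (X n ω)))
      linarith [hM (T n ω), hM (F (X n ω))]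
  have hfF : Continuous fun x => f (F x) := f.continuous.comp hFc
  have hcut : Continuous fun x : D => 2 * M * cutoff R x := (continuous_cutoff R).const_mul _
  have hcut0 : ∀ x : D, 0 ≤ 2 * M * cutoff R x := fun x =>
    mul_nonneg (by positivity) (cutoff_nonneg R x)
  have hcut1 : ∀ x : D, 2 * M * cutoff R x ≤ 2 * M := fun x =>
    mul_le_of_le_one_right (by positivity) (cutoff_le_one R x)
  have hup := hX.tendsto (g := fun x => f (F x) + 2 * M * cutoff R x) (hfF.add hcut)
    (C := 3 * M) fun x => abs_le.2 ⟨by linarith [(abs_le.1 (hM (F x))).1, hcut0 x],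
      by linarith [(abs_le.1 (hM (F x))).2, hcut1 x]⟩
  have hlow := hX.tendsto (g := fun x => f (F x) - 2 * M * cutoff R x) (hfF.sub hcut)
    (C := 3 * M) fun x => abs_le.2 ⟨by linarith [(abs_le.1 (hM (F x))).1, hcut1 x],
      by linarith [(abs_le.1 (hM (F x))).2, hcut0 x]⟩
  have hi1 : Integrable (fun x => f (F (w x))) P₀ := integrable_comp_borel hX.1 hfF fun x => hM _
  have hi2 : Integrable (fun x => 2 * M * cutoff R (w x)) P₀ :=
    integrable_comp_borel hX.1 hcut (C := 2 * M) fun x => by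
      rw [abs_of_nonneg (hcut0 x)]; exact hcut1 x
  rw [integral_add hi1 hi2] at hup
  rw [integral_sub hi1 hi2] at hlow
  have hI : ∫ x, 2 * M * cutoff R (w x) ∂P₀ < ε / 4 := by
    rw [integral_const_mul]
    calc 2 * M * ∫ x, cutoff R (w x) ∂P₀ < 2 * M * (ε / (8 * M)) :=
          mul_lt_mul_of_pos_left hR (by positivity)
      _ = ε / 4 := by field_simp; norm_num
  have e1 := hup.eventually_lt_const (u := ∫ x, f (F (w x)) ∂P₀ + ε / 2) (by linarith)
  have e2 := hlow.eventually_const_lt (u := ∫ x, f (F (w x)) ∂P₀ - ε / 2) (by linarith)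
  obtain ⟨N, hN⟩ := eventually_atTop.1 (hclose.and (e1.and e2))
  refine ⟨N, fun n hn => ?_⟩
  obtain ⟨h1, h2, h3⟩ := hN n hn.le
  have u1 : outerExp P (fun ω => f (T n ω)) ≤
      outerExp P (fun ω => (f (F (X n ω)) + 2 * M * cutoff R (X n ω)) + ε / 8) :=
    outerExp_mono (c := -M) (C := 3 * M + ε / 8) (fun ω => (abs_le.1 (hM _)).1)
      (fun ω => by linarith [(abs_le.1 (hM (F (X n ω)))).2, hcut1 (X n ω)])
      fun ω => by linarith [(abs_le.1 (h1 ω)).2]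
  have u2 := outerExp_add_const_le (P := P)
    (T := fun ω => f (F (X n ω)) + 2 * M * cutoff R (X n ω)) (C := 3 * M)
    (fun ω => abs_le.2 ⟨by linarith [(abs_le.1 (hM (F (X n ω)))).1, hcut0 (X n ω)],
      by linarith [(abs_le.1 (hM (F (X n ω)))).2, hcut1 (X n ω)]⟩) (ε / 8)
  have l1 : outerExp P (fun ω => f (F (X n ω)) - 2 * M * cutoff R (X n ω)) ≤
      outerExp P (fun ω => f (T n ω) + ε / 8) :=
    outerExp_mono (c := -(3 * M)) (C := M + ε / 8)
      (fun ω => by linarith [(abs_le.1 (hM (F (X n ω)))).1, hcut1 (X n ω)])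
      (fun ω => by linarith [(abs_le.1 (hM (T n ω))).2])
      fun ω => by linarith [(abs_le.1 (h1 ω)).1]
  have l2 := outerExp_add_const_le (P := P) (T := fun ω => f (T n ω)) (C := M)
    (fun ω => hM _) (ε / 8)
  rw [Real.dist_eq, abs_lt]
  constructor <;> linarith

/-- Conditional continuous mapping theorem with a perturbation that is negligible on balls, in
outer probability. -/
lemma CondWeakConv.map_of_close {X : ℕ → Ω → Ω' → D} {w : Ω₀ → D}
    (hX : CondWeakConv P P' X P₀ w) {F : D → ℝ}
    (hF : ∀ R : ℝ, ∃ K : ℝ, 0 ≤ K ∧ ∀ x y, ‖x‖ ≤ R → ‖y‖ ≤ R → |F x - F y| ≤ K * ‖x - y‖)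
    {T : ℕ → Ω → Ω' → ℝ}
    (hT : ∀ R ε : ℝ, 0 < ε → Tendsto
      (fun n => P {ω | ∃ ω', ‖X n ω ω'‖ ≤ R ∧ ε < |T n ω ω' - F (X n ω ω')|}) atTop (𝓝 0)) :
    CondWeakConv P P' T P₀ (fun x => F (w x)) := by
  have hFc := continuous_of_lipschitz_on_balls hF
  refine ⟨aemeasurable_comp_borel hX.1 hFc, fun ε hε => ?_⟩
  obtain ⟨R, hR0, hR⟩ := exists_integral_cutoff_lt hX.1 (ε := ε / 8) (by positivity)
  obtain ⟨K, hK0, hK⟩ := hF (R + 1)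
  have hlim := (hX.tendsto_ball (K := K + 2) (ε := ε / 8) (by positivity) (by positivity)).add
    (hT (R + 1) (ε / 8) (by positivity))
  rw [add_zero] at hlim
  refine tendsto_of_tendsto_of_tendsto_of_le_of_le tendsto_const_nhds hlim (fun _ => zero_le)
    fun n => (measure_mono ?_).trans (measure_union_le _ _)
  rintro ω ⟨h, ⟨hb, hl⟩, hlt⟩
  by_contra hω
  rw [Set.mem_union, not_or] at hω
  obtain ⟨hω1, hω2⟩ := hω
  simp only [Set.mem_ofPred_eq, not_exists, not_and, not_lt] at hω1 hω2
  set χ : D → ℝ := cutoff R with hχ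
  have χ0 : ∀ x, 0 ≤ χ x := cutoff_nonneg R
  have χ1 : ∀ x, χ x ≤ 1 := cutoff_le_one R
  set g : D → ℝ := fun x => h (F x) with hg
  have gb : ∀ x, -1 ≤ g x ∧ g x ≤ 1 := fun x => abs_le.1 (hb (F x))
  have hgc : Continuous g := hl.continuous.comp hFc
  set k : D → ℝ := fun x => g x * (1 - χ x) with hk
  have kb : ∀ x, |k x| ≤ 1 - χ x := fun x => by
    rw [hk, abs_mul, abs_of_nonneg (by linarith [χ1 x] : 0 ≤ 1 - χ x)]
    exact mul_le_of_le_one_left (by linarith [χ1 x]) (hb (F x))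
  -- the localized test function is globally Lipschitz, uniformly in `h`
  have kl : ∀ x y, |k x - k y| ≤ (K + 1) * ‖x - y‖ := by
    have key : ∀ x y : D, R + 1 ≤ ‖y‖ → |k x - k y| ≤ (K + 1) * ‖x - y‖ := fun x y hy => by
      have hy1 : χ y = 1 := cutoff_eq_one hy
      have hky : k y = 0 := by rw [hk]; simp [hy1]
      have h1 := abs_cutoff_sub_le R x y
      have h2 := kb x
      have h3 := (abs_le.1 h1).1
      have h4 := mul_nonneg hK0 (norm_nonneg (x - y))
      rw [hky, sub_zero]
      change χ y = 1 at hy1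
      change -‖x - y‖ ≤ χ x - χ y at h3
      linarith
    intro x y
    rcases le_total (R + 1) ‖y‖ with hy | hy
    · exact key x y hy
    rcases le_total (R + 1) ‖x‖ with hx | hx
    · rw [abs_sub_comm, norm_sub_rev]; exact key y x hx
    have h1 : |g x - g y| ≤ K * ‖x - y‖ := by
      have := hl.dist_le_mul (F x) (F y)
      rw [NNReal.coe_one, one_mul, Real.dist_eq, Real.dist_eq] at this
      exact this.trans (hK x y hx hy)
    have h2 : |χ y - χ x| ≤ ‖x - y‖ := by
      rw [abs_sub_comm]; exact abs_cutoff_sub_le R x y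
    have e : k x - k y = (g x - g y) * (1 - χ x) + g y * (χ y - χ x) := by rw [hk]; ring
    rw [e]
    refine (abs_add_le _ _).trans ?_
    rw [abs_mul, abs_mul, abs_of_nonneg (by linarith [χ1 x] : 0 ≤ 1 - χ x)]
    have h3 : |g x - g y| * (1 - χ x) ≤ |g x - g y| :=
      mul_le_of_le_one_right (abs_nonneg _) (by linarith [χ0 x])
    have h4 : |g y| * |χ y - χ x| ≤ |χ y - χ x| :=
      mul_le_of_le_one_left (abs_nonneg _) (hb (F y))
    linarith
  have χl : ∀ x y, |χ x - χ y| ≤ ‖x - y‖ := abs_cutoff_sub_le R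
  have hclose : ∀ ω', |h (T n ω ω') - k (X n ω ω')| ≤ ε / 8 + χ (X n ω ω') := fun ω' => by
    rcases le_total ‖X n ω ω'‖ (R + 1) with hx | hx
    · have h1 := hω2 ω' hx
      have h2 := hl.dist_le_mul (T n ω ω') (F (X n ω ω'))
      rw [NNReal.coe_one, one_mul, Real.dist_eq, Real.dist_eq] at h2
      have e : h (T n ω ω') - k (X n ω ω') =
          (h (T n ω ω') - h (F (X n ω ω'))) + g (X n ω ω') * χ (X n ω ω') := by
        rw [hk, hg]; ring
      rw [e]
      refine (abs_add_le _ _).trans (add_le_add (h2.trans h1) ?_)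
      rw [abs_mul, abs_of_nonneg (χ0 _)]
      exact mul_le_of_le_one_left (χ0 _) (hb _)
    · have hx1 : χ (X n ω ω') = 1 := cutoff_eq_one hx
      have hkx : k (X n ω ω') = 0 := by rw [hk]; simp [hx1]
      rw [hkx, sub_zero, hx1]
      linarith [hb (T n ω ω')]
  have hup := hω1 (fun x => k x + χ x)
    (fun x => abs_le.2 ⟨by linarith [(abs_le.1 (kb x)).1, χ0 x, χ1 x],
      by linarith [(abs_le.1 (kb x)).2, χ1 x]⟩)
    (fun x y => by
      rw [dist_eq_norm, add_sub_add_comm]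
      exact (abs_add_le _ _).trans (by linarith [kl x y, χl x y]))
  have hlow := hω1 (fun x => k x - χ x)
    (fun x => abs_le.2 ⟨by linarith [(abs_le.1 (kb x)).1, χ0 x, χ1 x],
      by linarith [(abs_le.1 (kb x)).2, χ0 x]⟩)
    (fun x y => by
      rw [dist_eq_norm, sub_sub_sub_comm]
      exact (abs_sub _ _).trans (by linarith [kl x y, χl x y]))
  have hχc : Continuous χ := continuous_cutoff R
  have hkc : Continuous k := hgc.mul (continuous_const.sub hχc)
  have hgi : Integrable (fun x => g (w x)) P₀ := integrable_comp_borel hX.1 hgc fun x => hb _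
  have hχi : Integrable (fun x => χ (w x)) P₀ :=
    integrable_comp_borel hX.1 hχc (C := 1) fun x => by rw [abs_of_nonneg (χ0 x)]; exact χ1 x
  have hki : Integrable (fun x => k (w x)) P₀ :=
    integrable_comp_borel hX.1 hkc (C := 1) fun x => (kb x).trans (by linarith [χ0 x])
  have i1 : ∫ x, (k (w x) + χ (w x)) ∂P₀ ≤ ∫ x, g (w x) ∂P₀ + 2 * ∫ x, χ (w x) ∂P₀ := by
    rw [← integral_const_mul, ← integral_add hgi (hχi.const_mul 2)]
    refine integral_mono (hki.add hχi) (hgi.add (hχi.const_mul 2)) fun x => ?_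
    change g (w x) * (1 - χ (w x)) + χ (w x) ≤ g (w x) + 2 * χ (w x)
    nlinarith [χ0 (w x), (gb (w x)).1]
  have i2 : ∫ x, g (w x) ∂P₀ - 2 * ∫ x, χ (w x) ∂P₀ ≤ ∫ x, (k (w x) - χ (w x)) ∂P₀ := by
    rw [← integral_const_mul, ← integral_sub hgi (hχi.const_mul 2)]
    refine integral_mono (hgi.sub (hχi.const_mul 2)) (hki.sub hχi) fun x => ?_
    change g (w x) - 2 * χ (w x) ≤ g (w x) * (1 - χ (w x)) - χ (w x)
    nlinarith [χ0 (w x), (gb (w x)).2]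
  have u1 : outerExp P' (fun ω' => h (T n ω ω')) ≤
      outerExp P' (fun ω' => (k (X n ω ω') + χ (X n ω ω')) + ε / 8) :=
    outerExp_mono (c := -1) (C := 1 + ε / 8) (fun ω' => (abs_le.1 (hb _)).1)
      (fun ω' => by linarith [(abs_le.1 (kb (X n ω ω'))).2])
      fun ω' => by linarith [(abs_le.1 (hclose ω')).2]
  have u2 := outerExp_add_const_le (P := P') (T := fun ω' => k (X n ω ω') + χ (X n ω ω')) (C := 1)
    (fun ω' => abs_le.2 ⟨by linarith [(abs_le.1 (kb (X n ω ω'))).1, χ0 (X n ω ω')],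
      by linarith [(abs_le.1 (kb (X n ω ω'))).2]⟩) (ε / 8)
  have l1 : outerExp P' (fun ω' => k (X n ω ω') - χ (X n ω ω')) ≤
      outerExp P' (fun ω' => h (T n ω ω') + ε / 8) :=
    outerExp_mono (c := -1) (C := 1 + ε / 8)
      (fun ω' => by linarith [(abs_le.1 (kb (X n ω ω'))).1])
      (fun ω' => by linarith [(abs_le.1 (hb (T n ω ω'))).2])
      fun ω' => by linarith [(abs_le.1 (hclose ω')).1]
  have l2 := outerExp_add_const_le (P := P') (T := fun ω' => h (T n ω ω')) (C := 1)
    (fun ω' => hb _) (ε / 8)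
  have d1 := (abs_le.1 hup).2
  have d2 := (abs_le.1 hlow).1
  refine absurd hlt (not_lt.2 (abs_le.2 ⟨?_, ?_⟩)) <;> linarith

end Weak

/-! ### Bootstrap quantiles and rejection probabilities -/

section Quantile

variable {Ω Ω' Ω₀ : Type*} [MeasurableSpace Ω] [MeasurableSpace Ω'] [MeasurableSpace Ω₀]
  {P : Measure Ω} {P' : Measure Ω'} {P₀ : Measure Ω₀} [IsProbabilityMeasure P₀]

lemma tendsto_measureReal_zero {s : ℕ → Set Ω} (h : Tendsto (fun n => P (s n)) atTop (𝓝 0)) :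
    Tendsto (fun n => P.real (s n)) atTop (𝓝 0) := by
  exact (ENNReal.tendsto_toReal ENNReal.zero_ne_top).comp h

/-- Outer measure is continuous along increasing sequences of arbitrary sets, so the set defining a
quantile is not empty even if `T` is not measurable. -/
lemma le_bootQuantile [IsProbabilityMeasure P'] {T : Ω' → ℝ} {γ x : ℝ} (hγ : γ < 1)
    (h : P'.real {ω | T ω ≤ x} < γ) :
    x ≤ bootQuantile P' T γ := by
  refine le_csInf ?_ fun y hy => ?_
  · have hm : Monotone fun n : ℕ => {ω | T ω ≤ (n : ℝ)} := fun m n hmn ω (hω : T ω ≤ m) =>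
      hω.trans (Nat.cast_le.2 hmn)
    have hU : ⋃ n : ℕ, {ω | T ω ≤ (n : ℝ)} = Set.univ :=
      Set.eq_univ_of_forall fun ω => Set.mem_iUnion.2 (exists_nat_ge (T ω))
    have ht := tendsto_measure_iUnion_atTop (μ := P') hm
    rw [hU, measure_univ] at ht
    have ht' : Tendsto (fun n : ℕ => P'.real {ω | T ω ≤ (n : ℝ)}) atTop (𝓝 1) :=
      (ENNReal.tendsto_toReal ENNReal.one_ne_top).comp ht
    obtain ⟨n, hn⟩ := (ht'.eventually_const_lt hγ).exists
    exact ⟨n, le_of_lt hn⟩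
  · by_contra hxy
    have h1 : P'.real {ω | T ω ≤ y} ≤ P'.real {ω | T ω ≤ x} :=
      measureReal_mono fun ω hω => le_trans hω (not_le.1 hxy).le
    exact absurd (hy.trans h1) (not_le.2 h)

lemma bootQuantile_le {T : Ω' → ℝ} {γ x : ℝ} (hγ : 0 < γ) (h0 : ∀ ω, 0 ≤ T ω)
    (h : γ ≤ P'.real {ω | T ω ≤ x}) : bootQuantile P' T γ ≤ x := by
  refine csInf_le ⟨0, fun y hy => ?_⟩ h
  by_contra hy0
  have : {ω | T ω ≤ y} = ∅ :=
    Set.eq_empty_of_forall_notMem fun ω hω => hy0 ((h0 ω).trans hω)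
  have hy' : γ ≤ P'.real {ω | T ω ≤ y} := hy
  rw [this, measureReal_empty] at hy'
  linarith

lemma one_le_measureReal_add_compl [IsProbabilityMeasure P]
    (s : Set Ω) : 1 ≤ P.real s + P.real sᶜ := by
  have := measureReal_union_le (μ := P) s sᶜ
  rwa [Set.union_compl_self, probReal_univ] at this

lemma integral_le_measureReal_of_le_indicator {W : Ω₀ → ℝ} (hW : AEMeasurable W P₀) {f : ℝ → ℝ}
    (hf : Continuous f) (h0 : ∀ x, 0 ≤ f x) (h1 : ∀ x, f x ≤ 1) {s : Set ℝ}
    (hs : MeasurableSet s) (hfs : ∀ x, x ∉ s → f x = 0) :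
    ∫ x, f (W x) ∂P₀ ≤ P₀.real {x | W x ∈ s} := by
  have hns : NullMeasurableSet {x | W x ∈ s} P₀ := hW.nullMeasurable hs
  have hr : P₀.real {x | W x ∈ s} = ∫ x, ({x | W x ∈ s}.indicator 1 : Ω₀ → ℝ) x ∂P₀ := by
    rw [integral_indicator₀ hns]
    simp
  rw [hr]
  refine integral_mono (Integrable.of_bound
    (hf.measurable.comp_aemeasurable hW).aestronglyMeasurable 1
      (Eventually.of_forall fun x => ?_)) ((integrable_const (1 : ℝ)).indicator₀ hns) fun x => ?_
  · rw [Real.norm_of_nonneg (h0 _)]; exact h1 _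
  · by_cases hx : W x ∈ s
    · rw [Set.indicator_of_mem (by exact hx)]; exact h1 _
    · rw [Set.indicator_of_notMem (by exact hx)]; exact (hfs _ hx).le

lemma integral_ramp_le {W : Ω₀ → ℝ} (hW : AEMeasurable W P₀) {a b : ℝ} (hab : a < b) :
    ∫ x, ramp (b - a)⁻¹ a (W x) ∂P₀ ≤ P₀.real {x | a < W x} :=
  integral_le_measureReal_of_le_indicator hW (continuous_ramp _ _) (ramp_nonneg _ _)
    (ramp_le_one _ _) measurableSet_Ioi fun _ hx =>
      ramp_eq_zero (inv_nonneg.2 (sub_pos.2 hab).le) (not_lt.1 hx)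

lemma integral_one_sub_ramp_le {W : Ω₀ → ℝ} (hW : AEMeasurable W P₀) {a b : ℝ} (hab : a < b) :
    ∫ x, (1 - ramp (b - a)⁻¹ a (W x)) ∂P₀ ≤ P₀.real {x | W x < b} :=
  integral_le_measureReal_of_le_indicator (f := fun y => 1 - ramp (b - a)⁻¹ a y) hW
    (continuous_const.sub (continuous_ramp _ _)) (fun x => by linarith [ramp_le_one (b - a)⁻¹ a x])
    (fun x => by linarith [ramp_nonneg (b - a)⁻¹ a x]) measurableSet_Iio fun _ hx =>
      sub_eq_zero.2 (ramp_eq_one hab (not_lt.1 hx)).symm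

lemma WeakConv.upper_tail [IsProbabilityMeasure P] {T : ℕ → Ω → ℝ} {W : Ω₀ → ℝ}
    (h : WeakConv P T P₀ W) {a b ε : ℝ}
    (hab : a < b) (hε : 0 < ε) :
    ∀ᶠ n in atTop, P.real {ω | b ≤ T n ω} < P₀.real {x | a < W x} + ε := by
  have ht := h.tendsto (continuous_ramp (b - a)⁻¹ a) (C := 1) fun x => by
    rw [abs_of_nonneg (ramp_nonneg _ _ _)]; exact ramp_le_one _ _ _
  have hi := integral_ramp_le h.1 hab
  filter_upwards [ht.eventually_lt_const (lt_of_le_of_lt hi (lt_add_of_pos_right _ hε))] with n hn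
  exact (measureReal_le_outerExp (fun _ => ramp_nonneg _ _ _) (fun _ => ramp_le_one _ _ _)
    fun ω hω => (ramp_eq_one hab hω).ge).trans_lt hn

lemma WeakConv.lower_tail [IsProbabilityMeasure P] {T : ℕ → Ω → ℝ} {W : Ω₀ → ℝ}
    (h : WeakConv P T P₀ W) {a b ε : ℝ}
    (hab : a < b) (hε : 0 < ε) :
    ∀ᶠ n in atTop, P.real {ω | T n ω ≤ a} < P₀.real {x | W x < b} + ε := by
  have h0 : ∀ x, 0 ≤ 1 - ramp (b - a)⁻¹ a x := fun x => by linarith [ramp_le_one (b - a)⁻¹ a x]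
  have h1 : ∀ x, 1 - ramp (b - a)⁻¹ a x ≤ 1 := fun x => by linarith [ramp_nonneg (b - a)⁻¹ a x]
  have ht := h.tendsto (g := fun x => 1 - ramp (b - a)⁻¹ a x)
    (continuous_const.sub (continuous_ramp (b - a)⁻¹ a)) (C := 1) fun x => by
      rw [abs_of_nonneg (h0 x)]; exact h1 x
  have hi := integral_one_sub_ramp_le h.1 hab
  filter_upwards [ht.eventually_lt_const (lt_of_le_of_lt hi (lt_add_of_pos_right _ hε))] with n hn
  refine (measureReal_le_outerExp (fun _ => h0 _) (fun _ => h1 _) fun ω hω => ?_).trans_lt hn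
  rw [ramp_eq_zero (inv_nonneg.2 (sub_pos.2 hab).le) hω, sub_zero]

lemma CondWeakConv.upper_tail [IsProbabilityMeasure P'] {T : ℕ → Ω → Ω' → ℝ} {W : Ω₀ → ℝ}
    (h : CondWeakConv P P' T P₀ W)
    {a b ε : ℝ} (hab : a < b) (hε : 0 < ε) :
    Tendsto (fun n => P {ω | P₀.real {x | a < W x} + ε < P'.real {ω' | b ≤ T n ω ω'}})
      atTop (𝓝 0) := by
  have hk : 0 < (b - a)⁻¹ := inv_pos.2 (sub_pos.2 hab)
  have hi := integral_ramp_le h.1 hab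
  refine tendsto_of_tendsto_of_tendsto_of_le_of_le tendsto_const_nhds
    (h.tendsto_ball (K := 1 + (b - a)⁻¹) (by positivity) hε) (fun _ => zero_le)
    fun n => measure_mono fun ω hω => ⟨ramp (b - a)⁻¹ a, fun x => ?_, fun x y => ?_, ?_⟩
  · rw [abs_of_nonneg (ramp_nonneg _ _ _)]
    linarith [ramp_le_one (b - a)⁻¹ a x]
  · refine (abs_ramp_sub_le hk.le a x y).trans ?_
    rw [Real.dist_eq]
    exact mul_le_mul_of_nonneg_right (by linarith) (abs_nonneg _)
  · have h1 := measureReal_le_outerExp (P := P') (A := {ω' | b ≤ T n ω ω'})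
      (T := fun ω' => ramp (b - a)⁻¹ a (T n ω ω'))
      (fun _ => ramp_nonneg _ _ _) (fun _ => ramp_le_one _ _ _)
      fun ω hω => (ramp_eq_one hab hω).ge
    have h2 : P₀.real {x | a < W x} + ε < P'.real {ω' | b ≤ T n ω ω'} := hω
    exact lt_of_lt_of_le (by linarith) (le_abs_self _)

lemma CondWeakConv.lower_tail [IsProbabilityMeasure P'] {T : ℕ → Ω → Ω' → ℝ} {W : Ω₀ → ℝ}
    (h : CondWeakConv P P' T P₀ W)
    {a b ε : ℝ} (hab : a < b) (hε : 0 < ε) :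
    Tendsto (fun n => P {ω | P₀.real {x | W x < b} + ε < P'.real {ω' | T n ω ω' ≤ a}})
      atTop (𝓝 0) := by
  have hk : 0 < (b - a)⁻¹ := inv_pos.2 (sub_pos.2 hab)
  have h0 : ∀ x, 0 ≤ 1 - ramp (b - a)⁻¹ a x := fun x => by linarith [ramp_le_one (b - a)⁻¹ a x]
  have h1 : ∀ x, 1 - ramp (b - a)⁻¹ a x ≤ 1 := fun x => by linarith [ramp_nonneg (b - a)⁻¹ a x]
  have hi := integral_one_sub_ramp_le h.1 hab
  refine tendsto_of_tendsto_of_tendsto_of_le_of_le tendsto_const_nhds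
    (h.tendsto_ball (K := 1 + (b - a)⁻¹) (by positivity) hε) (fun _ => zero_le)
    fun n => measure_mono fun ω hω =>
      ⟨fun x => 1 - ramp (b - a)⁻¹ a x, fun x => ?_, fun x y => ?_, ?_⟩
  · rw [abs_of_nonneg (h0 x)]
    linarith [h1 x]
  · rw [sub_sub_sub_cancel_left, abs_sub_comm]
    refine (abs_ramp_sub_le hk.le a x y).trans ?_
    rw [Real.dist_eq]
    exact mul_le_mul_of_nonneg_right (by linarith) (abs_nonneg _)
  · have h2 := measureReal_le_outerExp (P := P') (A := {ω' | T n ω ω' ≤ a})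
      (T := fun ω' => 1 - ramp (b - a)⁻¹ a (T n ω ω')) (fun _ => h0 _) (fun _ => h1 _)
      fun ω hω => by rw [ramp_eq_zero hk.le hω, sub_zero]
    have h3 : P₀.real {x | W x < b} + ε < P'.real {ω' | T n ω ω' ≤ a} := hω
    exact lt_of_lt_of_le (by linarith) (le_abs_self _)

/-- If no `γ`-quantile is an atom, the distribution function `G` approaches `γ` from below at its
smallest `γ`-quantile and from above at its largest one. -/
lemma exists_quantile_bounds {W : Ω₀ → ℝ} (hW : AEMeasurable W P₀) {γ δ : ℝ} (h0 : 0 < γ)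
    (h1 : γ < 1) (hδ : 0 < δ) (hna : NoAtomAtQuantile P₀ W γ) :
    (∃ z q : ℝ, z < q ∧ γ - δ < P₀.real {x | W x ≤ z} ∧
      ∀ y < q, P₀.real {x | W x ≤ y} < γ) ∧
    (∃ z q : ℝ, q < z ∧ P₀.real {x | W x ≤ z} < γ + δ ∧
      ∀ y, q < y → γ < P₀.real {x | W x ≤ y}) := by
  have : IsProbabilityMeasure (P₀.map W) := Measure.isProbabilityMeasure_map hW
  set G := cdf (P₀.map W) with hG
  have hGW : ∀ y, P₀.real {x | W x ≤ y} = G y := fun y => by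
    rw [hG, cdf_eq_real, measureReal_def, measureReal_def,
      Measure.map_apply_of_aemeasurable hW measurableSet_Iic]
    rfl
  have hbot : Tendsto G atBot (𝓝 0) := tendsto_cdf_atBot _
  have htop : Tendsto G atTop (𝓝 1) := tendsto_cdf_atTop _
  have hmono : Monotone G := monotone_cdf _
  -- a point where `G` crosses the level `γ` is a quantile, and `G` is continuous there
  have cross : ∀ q : ℝ, (∀ y < q, G y ≤ γ) → (∀ y, q < y → γ ≤ G y) →
      Function.leftLim G q = γ ∧ G q = γ := by
    intro q hlt hgt
    have hl : Function.leftLim G q ≤ γ := by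
      refine le_of_tendsto (hmono.tendsto_leftLim q) ?_
      filter_upwards [self_mem_nhdsWithin] with y hy using hlt y hy
    have hr : γ ≤ G q := by
      have := (G.right_continuous q).mono_left (nhdsWithin_mono q Set.Ioi_subset_Ici_self)
      refine ge_of_tendsto this ?_
      filter_upwards [self_mem_nhdsWithin] with y hy using hgt y hy
    have hIio : P₀.real {x | W x < q} = Function.leftLim G q := by
      have e := G.measure_Iio hbot q
      rw [hG, measure_cdf, Measure.map_apply_of_aemeasurable hW measurableSet_Iio] at e
      change P₀ {x | W x < q} = _ at e
      rw [measureReal_def, e, sub_zero, ENNReal.toReal_ofReal]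
      refine ge_of_tendsto (hmono.tendsto_leftLim q) (Eventually.of_forall fun y => ?_)
      exact cdf_nonneg _ y
    have hat := hna q (hIio.trans_le hl) ((hGW q).symm ▸ hr)
    have e := G.measure_singleton q
    rw [hG, measure_cdf, Measure.map_apply_of_aemeasurable hW (measurableSet_singleton q)] at e
    change P₀ {x | W x = q} = _ at e
    rw [hat] at e
    have hle := ENNReal.ofReal_eq_zero.1 e.symm
    constructor <;> linarith [hl, hr, hle]
  simp only [hGW]
  constructor
  · set s : Set ℝ := {x | γ ≤ G x} with hs
    have hne : s.Nonempty := by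
      obtain ⟨x, hx⟩ := (htop.eventually_const_lt h1).exists
      exact ⟨x, hx.le⟩
    have hbdd : BddBelow s := by
      obtain ⟨x, hx⟩ := (hbot.eventually_lt_const h0).exists
      refine ⟨x, fun y hy => ?_⟩
      by_contra hxy
      exact absurd (hmono (not_le.1 hxy).le) (not_le.2 (hx.trans_le hy))
    have hlt : ∀ y < sInf s, G y < γ := fun y hy =>
      not_le.1 fun h => notMem_of_lt_csInf (s := s) hy hbdd h
    have hgt : ∀ y, sInf s < y → γ ≤ G y := fun y hy => by
      obtain ⟨x, hx, hxy⟩ := exists_lt_of_csInf_lt hne hy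
      exact le_trans hx (hmono hxy.le)
    obtain ⟨hl, -⟩ := cross (sInf s) (fun y hy => (hlt y hy).le) hgt
    have ht := hmono.tendsto_leftLim (sInf s)
    rw [hl] at ht
    obtain ⟨z, hz1, hz2⟩ :=
      ((ht.eventually_const_lt (sub_lt_self γ hδ)).and self_mem_nhdsWithin).exists
    exact ⟨z, sInf s, hz2, hz1, hlt⟩
  · set s : Set ℝ := {x | γ < G x} with hs
    have hne : s.Nonempty := (htop.eventually_const_lt h1).exists
    have hbdd : BddBelow s := by
      obtain ⟨x, hx⟩ := (hbot.eventually_lt_const h0).exists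
      refine ⟨x, fun y hy => ?_⟩
      by_contra hxy
      exact absurd (hmono (not_le.1 hxy).le) (not_le.2 (hx.trans hy))
    have hlt : ∀ y < sInf s, G y ≤ γ := fun y hy =>
      not_lt.1 fun h => notMem_of_lt_csInf (s := s) hy hbdd h
    have hgt : ∀ y, sInf s < y → γ < G y := fun y hy => by
      obtain ⟨x, hx, hxy⟩ := exists_lt_of_csInf_lt hne hy
      exact lt_of_lt_of_le hx (hmono hxy.le)
    obtain ⟨-, hr⟩ := cross (sInf s) hlt fun y hy => (hgt y hy).le
    have ht := (G.right_continuous (sInf s)).mono_left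
      (nhdsWithin_mono (sInf s) Set.Ioi_subset_Ici_self)
    rw [hr] at ht
    obtain ⟨z, hz1, hz2⟩ :=
      ((ht.eventually_lt_const (lt_add_of_pos_right γ hδ)).and self_mem_nhdsWithin).exists
    exact ⟨z, sInf s, hz2, hz1, hgt⟩

/-- Asymptotic level of a bootstrap test: the bootstrap quantile is squeezed between points at
which the distribution function of the limit is close to `1 - α`. -/
theorem tendsto_rejectProb_null [IsProbabilityMeasure P] [IsProbabilityMeasure P']
    {T : ℕ → Ω → ℝ} {Tstar : ℕ → Ω → Ω' → ℝ} {W : Ω₀ → ℝ}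
    (hT : WeakConv P T P₀ W) (hTs : CondWeakConv P P' Tstar P₀ W)
    (h0 : ∀ n ω ω', 0 ≤ Tstar n ω ω') {α : ℝ} (hα0 : 0 < α) (hα1 : α < 1)
    (hna : NoAtomAtQuantile P₀ W (1 - α)) :
    Tendsto (fun n => rejectProb P P' (T n) (Tstar n) α) atTop (𝓝 α) := by
  have hW : AEMeasurable W P₀ := hT.1
  rw [Metric.tendsto_atTop']
  intro ε hε
  obtain ⟨⟨z₁, q₁, hzq₁, hz₁, hq₁⟩, ⟨z₂, q₂, hzq₂, hz₂, hq₂⟩⟩ :=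
    exists_quantile_bounds hW (by linarith : 0 < 1 - α) (by linarith) (by positivity : 0 < ε / 4)
      hna
  obtain ⟨x₁, hzx₁, hxq₁⟩ := exists_between hzq₁
  obtain ⟨y₁, hxy₁, hyq₁⟩ := exists_between hxq₁
  obtain ⟨x₂, hqx₂, hxz₂⟩ := exists_between hzq₂
  obtain ⟨y₂, hqy₂, hyx₂⟩ := exists_between hqx₂
  have compl : ∀ y, P₀.real {x | y < W x} = 1 - P₀.real {x | W x ≤ y} := fun y => by
    have hns : NullMeasurableSet {x | W x ≤ y} P₀ := hW.nullMeasurable measurableSet_Iic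
    rw [← probReal_compl_eq_one_sub₀ hns]
    congr 1
    ext x
    simp
  have strict : ∀ y, P₀.real {x | W x < y} ≤ P₀.real {x | W x ≤ y} := fun y =>
    measureReal_mono fun x (hx : W x < y) => hx.le
  -- slack for the two comparisons of bootstrap and limit distribution functions
  have hs₁ : 0 < (1 - α - P₀.real {x | W x ≤ y₁}) / 2 := by linarith [hq₁ y₁ hyq₁]
  have hs₂ : 0 < P₀.real {x | W x ≤ y₂} - (1 - α) := by linarith [hq₂ y₂ hqy₂]
  have b₁ := tendsto_measureReal_zero (hTs.lower_tail hxy₁ hs₁)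
  have b₂ := tendsto_measureReal_zero (hTs.upper_tail hyx₂ hs₂)
  obtain ⟨N, hN⟩ := eventually_atTop.1 (((b₁.eventually_lt_const (by positivity : 0 < ε / 4)).and
    (b₂.eventually_lt_const (by positivity : 0 < ε / 4))).and
    ((hT.upper_tail hzx₁ (by positivity : 0 < ε / 4)).and
      (hT.lower_tail hxz₂ (by positivity : 0 < ε / 4))))
  refine ⟨N, fun n hn => ?_⟩
  obtain ⟨⟨hb₁, hb₂⟩, hu, hl⟩ := hN n hn.le
  set A₁ := {ω | P₀.real {x | W x < y₁} + (1 - α - P₀.real {x | W x ≤ y₁}) / 2 <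
    P'.real {ω' | Tstar n ω ω' ≤ x₁}}
  set A₂ := {ω | P₀.real {x | y₂ < W x} + (P₀.real {x | W x ≤ y₂} - (1 - α)) <
    P'.real {ω' | x₂ ≤ Tstar n ω ω'}}
  have hlow : ∀ ω, ω ∉ A₁ → x₁ ≤ bootQuantile P' (Tstar n ω) (1 - α) := fun ω hω => by
    refine le_bootQuantile (by linarith) ?_
    have h1 : P'.real {ω' | Tstar n ω ω' ≤ x₁} ≤
      P₀.real {x | W x < y₁} + (1 - α - P₀.real {x | W x ≤ y₁}) / 2 := not_lt.1 hω
    linarith [strict y₁]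
  have hupp : ∀ ω, ω ∉ A₂ → bootQuantile P' (Tstar n ω) (1 - α) ≤ x₂ := fun ω hω => by
    refine bootQuantile_le (by linarith) (h0 n ω) ?_
    have h1 : P'.real {ω' | x₂ ≤ Tstar n ω ω'} ≤
      P₀.real {x | y₂ < W x} + (P₀.real {x | W x ≤ y₂} - (1 - α)) := not_lt.1 hω
    rw [compl] at h1
    have h2 := one_le_measureReal_add_compl (P := P') {ω' | Tstar n ω ω' ≤ x₂}
    have h3 : P'.real {ω' | Tstar n ω ω' ≤ x₂}ᶜ ≤ P'.real {ω' | x₂ ≤ Tstar n ω ω'} :=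
      measureReal_mono fun ω' (hω' : ¬ Tstar n ω ω' ≤ x₂) => (not_le.1 hω').le
    linarith
  have r1 : rejectProb P P' (T n) (Tstar n) α ≤ P.real {ω | x₁ ≤ T n ω} + P.real A₁ := by
    refine (measureReal_mono fun ω hω => ?_).trans (measureReal_union_le _ _)
    by_cases h : ω ∈ A₁
    · exact Or.inr h
    · exact Or.inl ((hlow ω h).trans (le_of_lt hω))
  have r2 : 1 ≤ rejectProb P P' (T n) (Tstar n) α + (P.real {ω | T n ω ≤ x₂} + P.real A₂) := by
    have h1 := one_le_measureReal_add_compl (P := P)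
      {ω | bootQuantile P' (Tstar n ω) (1 - α) < T n ω}
    have h2 : P.real {ω | bootQuantile P' (Tstar n ω) (1 - α) < T n ω}ᶜ ≤
        P.real {ω | T n ω ≤ x₂} + P.real A₂ := by
      refine (measureReal_mono fun ω hω => ?_).trans (measureReal_union_le _ _)
      by_cases h : ω ∈ A₂
      · exact Or.inr h
      · exact Or.inl ((not_lt.1 fun h => hω h).trans (hupp ω h))
    exact h1.trans (by rw [rejectProb]; linarith)
  rw [compl] at hu
  rw [Real.dist_eq, abs_lt]
  constructor <;> linarith [strict z₂]

/-- Asymptotic power of a bootstrap test: the bootstrap quantiles stay bounded in probability while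
the statistic exceeds every bound. -/
theorem tendsto_rejectProb_one [IsProbabilityMeasure P] [IsProbabilityMeasure P']
    {T : ℕ → Ω → ℝ} {Tstar : ℕ → Ω → Ω' → ℝ} {W : Ω₀ → ℝ}
    (hT : ∀ R : ℝ, Tendsto (fun n => P.real {ω | T n ω ≤ R}) atTop (𝓝 0))
    (hTs : CondWeakConv P P' Tstar P₀ W)
    (h0 : ∀ n ω ω', 0 ≤ Tstar n ω ω') {α : ℝ} (hα0 : 0 < α) (hα1 : α < 1) :
    Tendsto (fun n => rejectProb P P' (T n) (Tstar n) α) atTop (𝓝 1) := by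
  obtain ⟨R, hR⟩ := hTs.exists_bound hα0
  have hlim := ((tendsto_const_nhds (x := (1 : ℝ))).sub (hT R)).sub (tendsto_measureReal_zero hR)
  rw [sub_zero, sub_zero] at hlim
  refine tendsto_of_tendsto_of_tendsto_of_le_of_le hlim tendsto_const_nhds (fun n => ?_)
    fun n => measureReal_le_one
  have h1 := one_le_measureReal_add_compl (P := P)
    {ω | bootQuantile P' (Tstar n ω) (1 - α) < T n ω}
  have h2 : P.real {ω | bootQuantile P' (Tstar n ω) (1 - α) < T n ω}ᶜ ≤
      P.real {ω | T n ω ≤ R} + P.real {ω | α < P'.real {ω' | R < ‖Tstar n ω ω'‖}} := by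
    refine (measureReal_mono fun ω hω => ?_).trans (measureReal_union_le _ _)
    by_cases h : α < P'.real {ω' | R < ‖Tstar n ω ω'‖}
    · exact Or.inr h
    refine Or.inl ((not_lt.1 fun h => hω h).trans (bootQuantile_le (by linarith) (h0 n ω) ?_))
    have h3 := one_le_measureReal_add_compl (P := P') {ω' | Tstar n ω ω' ≤ R}
    have h4 : P'.real {ω' | Tstar n ω ω' ≤ R}ᶜ ≤ P'.real {ω' | R < ‖Tstar n ω ω'‖} :=
      measureReal_mono fun ω' (hω' : ¬ Tstar n ω ω' ≤ R) =>
        show R < ‖Tstar n ω ω'‖ from (not_le.1 hω').trans_le (le_abs_self _)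
    linarith [not_lt.1 h]
  simp only [rejectProb]
  linarith

end Quantile

/-! ### The Cramér-von Mises functional on all bounded paths -/

/-- The squared `L²(ν)` norm of a path, as a lower integral. It is finite and locally Lipschitz on
the whole of `l^∞`, whereas the Bochner integral jumps to `0` at paths that are not
`ν`-measurable; the two agree at `ν`-measurable paths. -/
noncomputable def lowerSqNorm {p q : ℕ} (ν : Measure unitInterval) (f : LInf p q) : ℝ :=
  (∫⁻ u, ENNReal.ofReal (‖f u‖ ^ 2) ∂ν).toReal

/-- The linear map `(a, b) ↦ Q a + b m` that gives the first-order expansion of the statistics. -/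
noncomputable def linearPart {p q : ℕ} (Q : Matrix (Fin p) (Fin p) ℝ) (m : LInf p q)
    (x : LInf p q × Matrix (Fin p) (Fin p) ℝ) : LInf p q :=
  leftMul Q x.1 + leftMul x.2 m

section Paths

variable {p q : ℕ} {ν : Measure unitInterval}

@[simp] lemma leftMul_apply (Q : Matrix (Fin p) (Fin p) ℝ) (f : LInf p q) (u : unitInterval) :
    leftMul Q f u = Q * f u := rfl

lemma norm_leftMul_le (Q : Matrix (Fin p) (Fin p) ℝ) (f : LInf p q) :
    ‖leftMul Q f‖ ≤ ‖Q‖ * ‖f‖ :=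
  lp.norm_le_of_forall_le (by positivity) fun u =>
    (Matrix.frobenius_norm_mul Q (f u)).trans (mul_le_mul_of_nonneg_left
      (lp.norm_apply_le_norm ENNReal.top_ne_zero f u) (norm_nonneg Q))

lemma linearPart_sub (Q : Matrix (Fin p) (Fin p) ℝ) (m : LInf p q)
    (x y : LInf p q × Matrix (Fin p) (Fin p) ℝ) :
    linearPart Q m x - linearPart Q m y = linearPart Q m (x - y) := by
  refine lp.ext (funext fun u => ?_)
  change (Q * x.1 u + x.2 * m u) - (Q * y.1 u + y.2 * m u) =
    Q * (x.1 u - y.1 u) + (x.2 - y.2) * m u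
  rw [Matrix.mul_sub, Matrix.sub_mul]
  abel

lemma norm_linearPart_le (Q : Matrix (Fin p) (Fin p) ℝ) (m : LInf p q)
    (x : LInf p q × Matrix (Fin p) (Fin p) ℝ) :
    ‖linearPart Q m x‖ ≤ (‖Q‖ + ‖m‖) * ‖x‖ := by
  have h1 := (norm_leftMul_le Q x.1).trans
    (mul_le_mul_of_nonneg_left (norm_fst_le x) (norm_nonneg Q))
  have h2 := (norm_leftMul_le x.2 m).trans
    (mul_le_mul_of_nonneg_right (norm_snd_le x) (norm_nonneg m))
  have h3 := norm_add_le (leftMul Q x.1) (leftMul x.2 m)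
  rw [linearPart]
  linarith

lemma frobenius_norm_sq {m n : ℕ} (A : Matrix (Fin m) (Fin n) ℝ) :
    ‖A‖ ^ 2 = ∑ i, ∑ j, A i j ^ 2 := by
  rw [Matrix.frobenius_norm_def, ← Real.sqrt_eq_rpow, Real.sq_sqrt (by positivity)]
  simp

lemma PathMeasurable.normSq {f : LInf p q} (hf : PathMeasurable ν f) :
    AEMeasurable (fun u => ‖f u‖ ^ 2) ν := by
  simp_rw [frobenius_norm_sq]
  exact Finset.aemeasurable_fun_sum _ fun i _ => Finset.aemeasurable_fun_sum _ fun j _ =>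
    (hf i j).pow_const 2

lemma PathMeasurable.add {f g : LInf p q} (hf : PathMeasurable ν f) (hg : PathMeasurable ν g) :
    PathMeasurable ν (f + g) := fun i j => (hf i j).add (hg i j)

lemma PathMeasurable.sub {f g : LInf p q} (hf : PathMeasurable ν f) (hg : PathMeasurable ν g) :
    PathMeasurable ν (f - g) := fun i j => (hf i j).sub (hg i j)

lemma PathMeasurable.smul {f : LInf p q} (hf : PathMeasurable ν f) (c : ℝ) :
    PathMeasurable ν (c • f) := fun i j => (hf i j).const_mul c

lemma PathMeasurable.leftMul {f : LInf p q} (hf : PathMeasurable ν f)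
    (Q : Matrix (Fin p) (Fin p) ℝ) : PathMeasurable ν (leftMul Q f) := fun i j => by
  simp only [leftMul_apply, Matrix.mul_apply]
  exact Finset.aemeasurable_fun_sum _ fun k _ => (hf k j).const_mul _

lemma PathMeasurable.of_continuous {f : LInf p q} (hf : Continuous fun u => f u) :
    PathMeasurable ν f := fun i j => (hf.matrix_elem i j).measurable.aemeasurable

lemma abs_entry_le_norm (f : LInf p q) (u : unitInterval) (i : Fin p) (j : Fin q) :
    |f u i j| ≤ ‖f‖ := by
  refine le_trans ?_ (lp.norm_apply_le_norm ENNReal.top_ne_zero f u)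
  refine abs_le_of_sq_le_sq ?_ (norm_nonneg _)
  rw [frobenius_norm_sq]
  exact (Finset.single_le_sum (f := fun j => f u i j ^ 2) (fun _ _ => sq_nonneg _)
    (Finset.mem_univ j)).trans (Finset.single_le_sum (f := fun i => ∑ j, f u i j ^ 2)
      (fun _ _ => Finset.sum_nonneg fun _ _ => sq_nonneg _) (Finset.mem_univ i))

/-- The `ν`-measurable paths form a closed set, as uniform limits preserve measurability. -/
lemma PathMeasurable.of_forall_close {f : LInf p q}
    (h : ∀ ε : ℝ, 0 < ε → ∃ g, PathMeasurable ν g ∧ ‖f - g‖ < ε) : PathMeasurable ν f := by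
  intro i j
  choose g hg hfg using fun n : ℕ => h (1 / ((n : ℝ) + 1)) (by positivity)
  refine aemeasurable_of_tendsto_metrizable_ae atTop (fun n => hg n i j)
    (Eventually.of_forall fun u => ?_)
  rw [tendsto_iff_dist_tendsto_zero]
  refine squeeze_zero (fun _ => dist_nonneg) (fun n => ?_)
    (tendsto_one_div_add_atTop_nhds_zero_nat (𝕜 := ℝ))
  rw [dist_comm, Real.dist_eq]
  exact (abs_entry_le_norm (f - g n) u i j).trans (hfg n).le

lemma lowerSqNorm_nonneg (f : LInf p q) : 0 ≤ lowerSqNorm ν f := ENNReal.toReal_nonneg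

lemma lowerSqNorm_eq_integral {f : LInf p q} (hf : PathMeasurable ν f) :
    lowerSqNorm ν f = ∫ u, ‖f u‖ ^ 2 ∂ν := by
  rw [lowerSqNorm, integral_eq_lintegral_of_nonneg_ae (Eventually.of_forall fun u => sq_nonneg _)
    hf.normSq.aestronglyMeasurable]

lemma lowerSqNorm_congr {f g : LInf p q} (h : ∀ᵐ u ∂ν, f u = g u) :
    lowerSqNorm ν f = lowerSqNorm ν g := by
  rw [lowerSqNorm, lowerSqNorm, lintegral_congr_ae]
  filter_upwards [h] with u hu
  rw [hu]

lemma lowerSqNorm_smul (c : ℝ) (f : LInf p q) :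
    lowerSqNorm ν (c • f) = c ^ 2 * lowerSqNorm ν f := by
  have : ∀ u, ENNReal.ofReal (‖(c • f) u‖ ^ 2) = ENNReal.ofReal (c ^ 2) *
      ENNReal.ofReal (‖f u‖ ^ 2) := fun u => by
    rw [← ENNReal.ofReal_mul (sq_nonneg c), lp.coeFn_smul, Pi.smul_apply, norm_smul, mul_pow,
      Real.norm_eq_abs, sq_abs]
  rw [lowerSqNorm, lintegral_congr this, lintegral_const_mul' _ _ ENNReal.ofReal_ne_top,
    ENNReal.toReal_mul, ENNReal.toReal_ofReal (sq_nonneg c), lowerSqNorm]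

lemma ae_eq_zero_of_lowerSqNorm_eq_zero [IsFiniteMeasure ν] {f : LInf p q}
    (hf : PathMeasurable ν f) (h : lowerSqNorm ν f = 0) : ∀ᵐ u ∂ν, f u = 0 := by
  rw [lowerSqNorm_eq_integral hf, integral_eq_zero_iff_of_nonneg (fun u => sq_nonneg _)] at h
  · filter_upwards [h] with u hu
    exact norm_eq_zero.1 (pow_eq_zero_iff two_ne_zero |>.1 hu)
  · refine Integrable.of_bound hf.normSq.aestronglyMeasurable (‖f‖ ^ 2)
      (Eventually.of_forall fun u => ?_)
    rw [Real.norm_of_nonneg (sq_nonneg _)]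
    gcongr
    exact lp.norm_apply_le_norm ENNReal.top_ne_zero f u

variable [IsProbabilityMeasure ν]

lemma abs_lowerSqNorm_sub_le (f g : LInf p q) :
    |lowerSqNorm ν f - lowerSqNorm ν g| ≤ (‖f‖ + ‖g‖) * ‖f - g‖ := by
  have fin : ∀ f : LInf p q, ∫⁻ u, ENNReal.ofReal (‖f u‖ ^ 2) ∂ν ≠ ∞ := fun f => by
    refine ne_top_of_le_ne_top ENNReal.ofReal_ne_top (b := ENNReal.ofReal (‖f‖ ^ 2)) ?_
    calc ∫⁻ u, ENNReal.ofReal (‖f u‖ ^ 2) ∂ν ≤ ∫⁻ _, ENNReal.ofReal (‖f‖ ^ 2) ∂ν := by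
          refine lintegral_mono fun u => ENNReal.ofReal_le_ofReal ?_
          gcongr
          exact lp.norm_apply_le_norm ENNReal.top_ne_zero f u
      _ = _ := by simp
  have key : ∀ f g : LInf p q,
      lowerSqNorm ν f ≤ lowerSqNorm ν g + (‖f‖ + ‖g‖) * ‖f - g‖ := fun f g => by
    have hc : 0 ≤ (‖f‖ + ‖g‖) * ‖f - g‖ := by positivity
    have h : ∫⁻ u, ENNReal.ofReal (‖f u‖ ^ 2) ∂ν ≤ ∫⁻ u, ENNReal.ofReal (‖g u‖ ^ 2) ∂ν +
        ENNReal.ofReal ((‖f‖ + ‖g‖) * ‖f - g‖) := by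
      calc ∫⁻ u, ENNReal.ofReal (‖f u‖ ^ 2) ∂ν
          ≤ ∫⁻ u, (ENNReal.ofReal (‖g u‖ ^ 2) +
              ENNReal.ofReal ((‖f‖ + ‖g‖) * ‖f - g‖)) ∂ν := by
            refine lintegral_mono fun u => ?_
            rw [← ENNReal.ofReal_add (sq_nonneg _) hc]
            refine ENNReal.ofReal_le_ofReal ?_
            have h1 := lp.norm_apply_le_norm ENNReal.top_ne_zero f u
            have h2 := lp.norm_apply_le_norm ENNReal.top_ne_zero g u
            have h3 : ‖f u - g u‖ ≤ ‖f - g‖ :=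
              lp.norm_apply_le_norm ENNReal.top_ne_zero (f - g) u
            have h4 := norm_sub_norm_le (f u) (g u)
            have h5 : (‖f u‖ + ‖g u‖) * (‖f u‖ - ‖g u‖) ≤ (‖f‖ + ‖g‖) * ‖f - g‖ :=
              (mul_le_mul_of_nonneg_left (h4.trans h3) (by positivity)).trans
                (mul_le_mul_of_nonneg_right (add_le_add h1 h2) (norm_nonneg _))
            linarith
        _ = _ := by rw [lintegral_add_right _ measurable_const]; simp
    have h' := ENNReal.toReal_mono (ENNReal.add_ne_top.2 ⟨fin g, ENNReal.ofReal_ne_top⟩) h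
    rwa [ENNReal.toReal_add (fin g) ENNReal.ofReal_ne_top, ENNReal.toReal_ofReal hc] at h'
  have h1 := key f g
  have h2 := key g f
  rw [norm_sub_rev g f] at h2
  rw [abs_le]
  constructor <;> linarith

lemma continuous_lowerSqNorm : Continuous (lowerSqNorm ν : LInf p q → ℝ) :=
  continuous_of_lipschitz_on_balls fun R => ⟨2 * |R|, by positivity, fun x y hx hy =>
    (abs_lowerSqNorm_sub_le x y).trans (mul_le_mul_of_nonneg_right
      (by linarith [le_abs_self R]) (norm_nonneg _))⟩

lemma lowerSqNorm_linearPart_lipschitz (Q : Matrix (Fin p) (Fin p) ℝ) (m : LInf p q) (R : ℝ) :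
    ∃ K : ℝ, 0 ≤ K ∧ ∀ x y : LInf p q × Matrix (Fin p) (Fin p) ℝ, ‖x‖ ≤ R → ‖y‖ ≤ R →
      |lowerSqNorm ν (linearPart Q m x) - lowerSqNorm ν (linearPart Q m y)| ≤ K * ‖x - y‖ := by
  set c := ‖Q‖ + ‖m‖ with hc
  have hc0 : 0 ≤ c := by positivity
  refine ⟨2 * (c * |R|) * c, by positivity, fun x y hx hy => ?_⟩
  refine (abs_lowerSqNorm_sub_le _ _).trans ?_
  rw [linearPart_sub, mul_assoc]
  refine mul_le_mul ?_ (norm_linearPart_le Q m (x - y)) (norm_nonneg _) (by positivity)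
  have h1 := (norm_linearPart_le Q m x).trans
    (mul_le_mul_of_nonneg_left (hx.trans (le_abs_self R)) hc0)
  have h2 := (norm_linearPart_le Q m y).trans
    (mul_le_mul_of_nonneg_left (hy.trans (le_abs_self R)) hc0)
  linarith

/-- Perturbations of order `n^{-1/2}` do not matter, uniformly on bounded sets. -/
lemma eventually_lowerSqNorm_close (A B : ℝ) {ε : ℝ} (hε : 0 < ε) :
    ∀ᶠ n : ℕ in atTop, ∀ f e : LInf p q, ‖f‖ ≤ A → ‖e‖ ≤ B →
      |lowerSqNorm ν (f + (Real.sqrt n)⁻¹ • e) - lowerSqNorm ν f| ≤ ε := by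
  have h0 : Tendsto (fun n : ℕ => (Real.sqrt n)⁻¹) atTop (𝓝 0) :=
    tendsto_inv_atTop_zero.comp (Real.tendsto_sqrt_atTop.comp tendsto_natCast_atTop_atTop)
  have h1 : Tendsto (fun n : ℕ => (2 * A + (Real.sqrt n)⁻¹ * B) * ((Real.sqrt n)⁻¹ * B)) atTop
      (𝓝 ((2 * A + 0 * B) * (0 * B))) :=
    (tendsto_const_nhds.add (h0.mul_const B)).mul (h0.mul_const B)
  rw [zero_mul, mul_zero] at h1
  filter_upwards [h1.eventually_lt_const hε] with n hn f e hf he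
  refine (abs_lowerSqNorm_sub_le _ _).trans (le_trans ?_ hn.le)
  have hr : ‖(Real.sqrt n)⁻¹ • e‖ ≤ (Real.sqrt n)⁻¹ * B := by
    rw [norm_smul, Real.norm_of_nonneg (inv_nonneg.2 (Real.sqrt_nonneg _))]
    exact mul_le_mul_of_nonneg_left he (inv_nonneg.2 (Real.sqrt_nonneg _))
  have hs := norm_add_le f ((Real.sqrt n)⁻¹ • e)
  rw [add_sub_cancel_left]
  exact mul_le_mul (by linarith) hr (norm_nonneg _)
    (by linarith [norm_nonneg f, norm_nonneg ((Real.sqrt n)⁻¹ • e)])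

end Paths

section Stat

variable {p q : ℕ} {ν : Measure unitInterval}

lemma cvm_eq {f : LInf p q} (hf : PathMeasurable ν f) (n : ℕ) (Q : Matrix (Fin p) (Fin p) ℝ) :
    cvm ν n Q f = n * lowerSqNorm ν (leftMul Q f) := by
  rw [cvm, lowerSqNorm_eq_integral (hf.leftMul Q)]
  rfl

lemma cvm_eq_lowerSqNorm_smul {f : LInf p q} (hf : PathMeasurable ν f) (n : ℕ)
    (Q : Matrix (Fin p) (Fin p) ℝ) :
    cvm ν n Q f = lowerSqNorm ν (Real.sqrt n • leftMul Q f) := by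
  rw [cvm_eq hf, lowerSqNorm_smul, Real.sq_sqrt (Nat.cast_nonneg n)]

lemma limitStat_eq {μ : LInf p q} (hμ : PathMeasurable ν μ) (Q : Matrix (Fin p) (Fin p) ℝ)
    {x : LInf p q × Matrix (Fin p) (Fin p) ℝ} (hx : PathMeasurable ν x.1) :
    limitStat ν Q μ x = lowerSqNorm ν (linearPart Q μ x) := by
  rw [linearPart, lowerSqNorm_eq_integral ((hx.leftMul Q).add (hμ.leftMul x.2))]
  rfl

lemma cvm_nonneg (n : ℕ) (Q : Matrix (Fin p) (Fin p) ℝ) (f : LInf p q) : 0 ≤ cvm ν n Q f :=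
  mul_nonneg (Nat.cast_nonneg n) (integral_nonneg fun _ => sq_nonneg _)

/-- Expansion of `Q̂ μ̂` around `Q μ`, where `x = s (μ̂ - μ, Q̂ - Q)`. -/
lemma leftMul_expansion {s : ℝ} (hs : s ≠ 0) (Q Qh : Matrix (Fin p) (Fin p) ℝ) (μ m : LInf p q)
    {x : LInf p q × Matrix (Fin p) (Fin p) ℝ} (hx : x = s • (m - μ, Qh - Q)) :
    leftMul Qh m = leftMul Q μ + s⁻¹ • (linearPart Q μ x + s⁻¹ • leftMul x.2 x.1) := by
  subst hx
  refine lp.ext (funext fun u => ?_)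
  change Qh * m u = Q * μ u + s⁻¹ • ((Q * (s • (m u - μ u)) + (s • (Qh - Q)) * μ u) +
    s⁻¹ • ((s • (Qh - Q)) * (s • (m u - μ u))))
  simp only [Matrix.mul_smul, Matrix.smul_mul, smul_add, smul_smul, inv_mul_cancel₀ hs, one_smul,
    Matrix.mul_sub, Matrix.sub_mul, smul_sub,
    inv_mul_cancel_left₀ hs]
  abel

/-- Expansion of the bootstrap process `s Q̂* ((I - Q̂) μ̂ + μ̂* - μ̂)`, where
`x = s (μ̂ - μ, Q̂ - Q)` and `y = s (μ̂* - μ̂, Q̂* - Q̂)`. As `Q̂ (I - Q̂) = 0`, there is no term of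
order `s`. -/
lemma constrained_expansion {s : ℝ} (hs : s ≠ 0) (Q Qh Qs : Matrix (Fin p) (Fin p) ℝ)
    (hQh : Qh * Qh = Qh) (μ m ms : LInf p q) {x y : LInf p q × Matrix (Fin p) (Fin p) ℝ}
    (hx : x = s • (m - μ, Qh - Q)) (hy : y = s • (ms - m, Qs - Qh)) :
    s • leftMul Qs (constrained Qh m ms) = linearPart Q (leftMul (1 - Q) μ) y +
      s⁻¹ • (leftMul (y.2 * (1 - Q)) x.1 - leftMul (y.2 * x.2) μ
        - s⁻¹ • leftMul (y.2 * x.2) x.1 + leftMul x.2 y.1 + leftMul y.2 y.1) := by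
  obtain ⟨a, b⟩ := x
  obtain ⟨a', b'⟩ := y
  rw [Prod.smul_mk, Prod.mk.injEq] at hx hy
  obtain ⟨ha, hb⟩ := hx
  obtain ⟨ha', hb'⟩ := hy
  have em : m = μ + s⁻¹ • a := by rw [ha, smul_smul, inv_mul_cancel₀ hs, one_smul]; abel
  have ems : ms - m = s⁻¹ • a' := by rw [ha', smul_smul, inv_mul_cancel₀ hs, one_smul]
  have eQh : Qh = Q + s⁻¹ • b := by rw [hb, smul_smul, inv_mul_cancel₀ hs, one_smul]; abel
  have eQs : Qs = Qh + s⁻¹ • b' := by rw [hb', smul_smul, inv_mul_cancel₀ hs, one_smul]; abel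
  refine lp.ext (funext fun u => ?_)
  have h1 : s • leftMul Qs (constrained Qh m ms) =
      leftMul (b' * (1 - Qh)) m + leftMul Qs a' := by
    refine lp.ext (funext fun v => ?_)
    have hz : Qh * (1 - Qh) = 0 := by rw [Matrix.mul_sub, Matrix.mul_one, hQh, sub_self]
    rw [constrained, ems]
    change s • (Qs * ((1 - Qh) * m v + s⁻¹ • a' v)) = (b' * (1 - Qh)) * m v + Qs * a' v
    rw [Matrix.mul_add, ← Matrix.mul_assoc, Matrix.mul_smul, smul_add, smul_smul,
      mul_inv_cancel₀ hs, one_smul]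
    congr 1
    rw [eQs, Matrix.add_mul, hz, zero_add, Matrix.smul_mul, Matrix.smul_mul, smul_smul,
      mul_inv_cancel₀ hs, one_smul]
  rw [h1, eQs, eQh, em]
  change (b' * (1 - (Q + s⁻¹ • b))) * (μ u + s⁻¹ • a u) + (Q + s⁻¹ • b + s⁻¹ • b') * a' u =
    (Q * a' u + b' * ((1 - Q) * μ u)) + s⁻¹ • ((b' * (1 - Q)) * a u - (b' * b) * μ u
      - s⁻¹ • ((b' * b) * a u) + b * a' u + b' * a' u)
  simp only [Matrix.mul_smul, Matrix.smul_mul, smul_add, smul_sub, Matrix.mul_add, Matrix.add_mul,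
    Matrix.mul_sub, Matrix.sub_mul, Matrix.mul_one, Matrix.one_mul, Matrix.mul_assoc]
  abel

end Stat

/-! ### A bootstrap test with an idempotent estimator -/

section Transfer

variable {Ω Ω' Ω₀ Ω₁ D : Type*} [MeasurableSpace Ω] [MeasurableSpace Ω'] [MeasurableSpace Ω₀]
  [MeasurableSpace Ω₁] {P : Measure Ω} {P' : Measure Ω'} {P₀ : Measure Ω₀} {P₁ : Measure Ω₁}

lemma WeakConv.congr_ae {T : ℕ → Ω → ℝ} {V W : Ω₀ → ℝ} (h : WeakConv P T P₀ V)
    (hVW : V =ᵐ[P₀] W) : WeakConv P T P₀ W := by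
  refine ⟨h.1.congr hVW, fun f => ?_⟩
  have : ∫ x, f (W x) ∂P₀ = ∫ x, f (V x) ∂P₀ := integral_congr_ae <| by
    filter_upwards [hVW] with x hx
    rw [hx]
  rw [this]
  exact h.2 f

/-- Only the law of the limit matters; it may live on another probability space. -/
lemma CondWeakConv.congr_identDistrib {T : ℕ → Ω → Ω' → ℝ} {V : Ω₁ → ℝ} {W : Ω₀ → ℝ}
    (h : CondWeakConv P P' T P₁ V) (hVW : IdentDistrib V W P₁ P₀) :
    CondWeakConv P P' T P₀ W := by
  refine ⟨hVW.aemeasurable_snd, fun ε hε => ?_⟩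
  have e : ∀ f ∈ BL₁ ℝ, ∫ x, f (W x) ∂P₀ = ∫ x, f (V x) ∂P₁ := fun f hf =>
    (hVW.comp hf.2.continuous.measurable).integral_eq.symm
  refine (h.2 ε hε).congr fun n => ?_
  congr 1
  ext ω
  refine exists_congr fun f => and_congr_right fun hf => ?_
  rw [e f hf]

/-- Weak limits stay in the closure of a set that carries the sequence. -/
lemma WeakConv.ae_mem_closure [IsProbabilityMeasure P] [IsProbabilityMeasure P₀]
    [PseudoMetricSpace D] {X : ℕ → Ω → D} {w : Ω₀ → D} (h : WeakConv P X P₀ w) {s : Set D}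
    (hs : s.Nonempty) (hX : ∀ n ω, X n ω ∈ s) : ∀ᵐ x ∂P₀, w x ∈ closure s := by
  set g : D → ℝ := fun x => min 1 (Metric.infDist x s) with hg
  have g0 : ∀ x, 0 ≤ g x := fun x => le_min zero_le_one Metric.infDist_nonneg
  have hgc : Continuous g := continuous_const.min (Metric.continuous_infDist_pt s)
  have gb : ∀ x, |g x| ≤ 1 := fun x => by rw [abs_of_nonneg (g0 x)]; exact min_le_left _ _
  have hgX : ∀ n, outerExp P (fun ω => g (X n ω)) = 0 := fun n => by
    have : (fun ω => g (X n ω)) = fun _ => (0 : ℝ) := funext fun ω => by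
      simp only [hg]
      rw [Metric.infDist_zero_of_mem (hX n ω), min_eq_right zero_le_one]
    rw [this, outerExp_const]
  have ht := h.tendsto hgc gb
  simp only [hgX] at ht
  have hz := tendsto_nhds_unique ht tendsto_const_nhds
  rw [integral_eq_zero_iff_of_nonneg (fun x => g0 (w x)) (integrable_comp_borel h.1 hgc gb)] at hz
  filter_upwards [hz] with x hx
  rw [Metric.mem_closure_iff_infDist_zero hs]
  have hx' : min 1 (Metric.infDist (w x) s) = 0 := hx
  rcases min_choice 1 (Metric.infDist (w x) s) with h1 | h1
  · rw [h1] at hx'; exact absurd hx' one_ne_zero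
  · rw [← h1]; exact hx'

/-- Events that, for large `n`, only occur outside any given ball have small outer probability. -/
lemma WeakConv.tendsto_measure_zero [IsProbabilityMeasure P] [IsProbabilityMeasure P₀]
    [SeminormedAddCommGroup D] {X : ℕ → Ω → D} {w : Ω₀ → D} (h : WeakConv P X P₀ w)
    {s : ℕ → Set Ω} (hs : ∀ R : ℝ, ∀ᶠ n in atTop, ∀ ω ∈ s n, R < ‖X n ω‖) :
    Tendsto (fun n => P (s n)) atTop (𝓝 0) := by
  rw [ENNReal.tendsto_nhds_zero]
  intro ε hε
  obtain ⟨δ, hδ0, hδ1, hδ2⟩ := ENNReal.lt_iff_exists_real_btwn.1 hε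
  have hδpos : 0 < δ := by
    by_contra hn
    rw [ENNReal.ofReal_of_nonpos (not_lt.1 hn)] at hδ1
    exact lt_irrefl _ hδ1
  obtain ⟨R, -, hR⟩ := h.exists_bound hδpos
  filter_upwards [hR, hs R] with n h1 h2
  have hsub : s n ⊆ {ω | R < ‖X n ω‖} := h2
  refine (measure_mono hsub).trans (le_trans ?_ hδ2.le)
  rw [← ENNReal.ofReal_toReal (measure_ne_top P {ω | R < ‖X n ω‖})]
  exact ENNReal.ofReal_le_ofReal h1.le

end Transfer

section Consistency

variable {Ω Ω' Ω₀ Ω₁ : Type*} [MeasurableSpace Ω] [MeasurableSpace Ω'] [MeasurableSpace Ω₀]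
  [MeasurableSpace Ω₁] {P : Measure Ω} [IsProbabilityMeasure P]
  {P' : Measure Ω'} [IsProbabilityMeasure P'] {P₀ : Measure Ω₀} [IsProbabilityMeasure P₀]
  {P₁ : Measure Ω₁} [IsProbabilityMeasure P₁] {p q : ℕ}
  {data : (n : ℕ) → Ω → Data p n} {ν : Measure unitInterval}
  {μ : LInf p q} {muHat : (n : ℕ) → Data p n → LInf p q}
  {muStar : (n : ℕ) → Data p n → Ω' → LInf p q}
  {Q : Matrix (Fin p) (Fin p) ℝ} {Qhat : (n : ℕ) → Data p n → Matrix (Fin p) (Fin p) ℝ}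
  {Qstar : (n : ℕ) → Data p n → Ω' → Matrix (Fin p) (Fin p) ℝ}
  {w : Ω₀ → LInf p q × Matrix (Fin p) (Fin p) ℝ} {w' : Ω₁ → LInf p q × Matrix (Fin p) (Fin p) ℝ}

/-- The limit process inherits measurable paths from the estimators, although `l^∞` is not
separable. -/
lemma JointWeakLimit.ae_pathMeasurable (hμ : PathMeasurable ν μ)
    (hmuHat : ∀ n s, PathMeasurable ν (muHat n s))
    (hA2 : JointWeakLimit P data muHat μ Qhat Q P₀ w) :
    ∀ᵐ x ∂P₀, PathMeasurable ν (w x).1 := by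
  have h := hA2.ae_mem_closure (s := {x | PathMeasurable ν x.1}) ⟨(μ, 0), hμ⟩ fun n ω =>
    ((hmuHat n (data n ω)).sub hμ).smul (Real.sqrt n)
  filter_upwards [h] with x hx
  refine PathMeasurable.of_forall_close fun ε hε => ?_
  obtain ⟨y, hy, hxy⟩ := Metric.mem_closure_iff.1 hx ε hε
  refine ⟨y.1, hy, ?_⟩
  rw [dist_eq_norm] at hxy
  exact (norm_fst_le (w x - y)).trans_lt hxy

variable [IsProbabilityMeasure ν]

/-- Under the null hypothesis `Q μ = 0`, the statistic is a small perturbation of a continuous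
functional of the estimation error. -/
lemma weakConv_cvm (hμ : PathMeasurable ν μ) (hmuHat : ∀ n s, PathMeasurable ν (muHat n s))
    (hA2 : JointWeakLimit P data muHat μ Qhat Q P₀ w) (h0 : ∀ᵐ u ∂ν, leftMul Q μ u = 0) :
    WeakConv P (fun n ω => cvm ν n (Qhat n (data n ω)) (muHat n (data n ω))) P₀
      (fun x => limitStat ν Q μ (w x)) := by
  refine WeakConv.congr_ae (V := fun x => lowerSqNorm ν (linearPart Q μ (w x)))
    (WeakConv.map_of_close hA2 (F := fun x => lowerSqNorm ν (linearPart Q μ x))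
      (lowerSqNorm_linearPart_lipschitz Q μ) fun R ε hε => ?_) ?_
  · filter_upwards [eventually_lowerSqNorm_close (ν := ν) (p := p) (q := q) ((‖Q‖ + ‖μ‖) * R)
      (R * R) hε, eventually_gt_atTop 0] with n hn hpos ω hω
    have hs : Real.sqrt n ≠ 0 := (Real.sqrt_pos.2 (Nat.cast_pos.2 hpos)).ne'
    set x := Real.sqrt n • (muHat n (data n ω) - μ, Qhat n (data n ω) - Q) with hx
    have hR : 0 ≤ R := (norm_nonneg x).trans hω
    rw [cvm_eq_lowerSqNorm_smul (hmuHat n _), leftMul_expansion hs Q _ μ _ hx]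
    have e : lowerSqNorm ν (Real.sqrt n • (leftMul Q μ + (Real.sqrt n)⁻¹ •
        (linearPart Q μ x + (Real.sqrt n)⁻¹ • leftMul x.2 x.1))) =
        lowerSqNorm ν (linearPart Q μ x + (Real.sqrt n)⁻¹ • leftMul x.2 x.1) := by
      rw [smul_add, smul_smul, mul_inv_cancel₀ hs, one_smul]
      refine lowerSqNorm_congr ?_
      filter_upwards [h0] with u hu
      change Real.sqrt n • leftMul Q μ u + _ = _
      rw [hu, smul_zero, zero_add]
    rw [e]
    refine hn _ _ ((norm_linearPart_le Q μ x).trans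
      (mul_le_mul_of_nonneg_left hω (by positivity))) ?_
    exact (norm_leftMul_le _ _).trans
      (mul_le_mul ((norm_snd_le x).trans hω) ((norm_fst_le x).trans hω) (norm_nonneg _) hR)
  · filter_upwards [hA2.ae_pathMeasurable hμ hmuHat] with x hx
    exact (limitStat_eq hμ Q hx).symm

/-- The constrained bootstrap statistic has a conditional weak limit whether or not the null
hypothesis holds. -/
lemma condWeakConv_cvm (hmuHat : ∀ n s, PathMeasurable ν (muHat n s))
    (hmuStar : ∀ n s ω', PathMeasurable ν (muStar n s ω'))
    (hQhat : ∀ n s, Qhat n s * Qhat n s = Qhat n s)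
    (hA2 : JointWeakLimit P data muHat μ Qhat Q P₀ w)
    (hA3 : CondWeakConv P P' (fun n ω ω' => Real.sqrt n • (muStar n (data n ω) ω' -
      muHat n (data n ω), Qstar n (data n ω) ω' - Qhat n (data n ω))) P₁ w') :
    CondWeakConv P P' (fun n ω ω' => cvm ν n (Qstar n (data n ω) ω')
        (constrained (Qhat n (data n ω)) (muHat n (data n ω)) (muStar n (data n ω) ω')))
      P₁ (fun x => lowerSqNorm ν (linearPart Q (leftMul (1 - Q) μ) (w' x))) := by
  set m := leftMul (1 - Q) μ with hm
  refine CondWeakConv.map_of_close hA3 (F := fun x => lowerSqNorm ν (linearPart Q m x))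
    (lowerSqNorm_linearPart_lipschitz Q m) fun R ε hε => ?_
  refine WeakConv.tendsto_measure_zero hA2 fun R₀ => ?_
  set B := R * ‖1 - Q‖ * R₀ + R * R₀ * ‖μ‖ + R * R₀ * R₀ + R₀ * R + R * R with hB
  filter_upwards [eventually_lowerSqNorm_close (ν := ν) (p := p) (q := q) ((‖Q‖ + ‖m‖) * R)
    B hε, eventually_gt_atTop 0] with n hn hpos ω hω
  obtain ⟨ω', hω', hlt⟩ := hω
  by_contra hR₀
  have hs1 : 1 ≤ Real.sqrt n := Real.one_le_sqrt.2 (Nat.one_le_cast.2 hpos)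
  have hs : Real.sqrt n ≠ 0 := by positivity
  set x := Real.sqrt n • (muHat n (data n ω) - μ, Qhat n (data n ω) - Q) with hx
  set y := Real.sqrt n • (muStar n (data n ω) ω' - muHat n (data n ω),
    Qstar n (data n ω) ω' - Qhat n (data n ω)) with hy
  have hxR : ‖x‖ ≤ R₀ := not_lt.1 hR₀
  have hR0 : 0 ≤ R := (norm_nonneg y).trans hω'
  have hR1 : 0 ≤ R₀ := (norm_nonneg x).trans hxR
  have x1 := (norm_fst_le x).trans hxR
  have x2 := (norm_snd_le x).trans hxR
  have y1 := (norm_fst_le y).trans hω'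
  have y2 := (norm_snd_le y).trans hω'
  have hpm : PathMeasurable ν (constrained (Qhat n (data n ω)) (muHat n (data n ω))
      (muStar n (data n ω) ω')) :=
    ((hmuHat n _).leftMul _).add ((hmuStar n _ ω').sub (hmuHat n _))
  rw [cvm_eq_lowerSqNorm_smul hpm,
    constrained_expansion hs Q _ _ (hQhat n _) μ _ _ hx hy] at hlt
  refine absurd hlt (not_lt.2 (hn _ _ ((norm_linearPart_le Q m y).trans
      (mul_le_mul_of_nonneg_left hω' (by positivity))) ?_))
  have t1 : ‖leftMul (y.2 * (1 - Q)) x.1‖ ≤ R * ‖1 - Q‖ * R₀ := by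
    refine (norm_leftMul_le _ _).trans (mul_le_mul ((Matrix.frobenius_norm_mul _ _).trans
      (mul_le_mul_of_nonneg_right y2 (norm_nonneg _))) x1 (norm_nonneg _) (by positivity))
  have h22 : ‖y.2 * x.2‖ ≤ R * R₀ := (Matrix.frobenius_norm_mul _ _).trans
    (mul_le_mul y2 x2 (norm_nonneg _) hR0)
  have t2 : ‖leftMul (y.2 * x.2) μ‖ ≤ R * R₀ * ‖μ‖ :=
    (norm_leftMul_le _ _).trans (mul_le_mul_of_nonneg_right h22 (norm_nonneg _))
  have t3 : ‖(Real.sqrt n)⁻¹ • leftMul (y.2 * x.2) x.1‖ ≤ R * R₀ * R₀ := by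
    rw [norm_smul, Real.norm_of_nonneg (inv_nonneg.2 (Real.sqrt_nonneg _))]
    exact (mul_le_of_le_one_left (norm_nonneg _) (inv_le_one_of_one_le₀ hs1)).trans
      ((norm_leftMul_le _ _).trans (mul_le_mul h22 x1 (norm_nonneg _) (by positivity)))
  have t4 : ‖leftMul x.2 y.1‖ ≤ R₀ * R :=
    (norm_leftMul_le _ _).trans (mul_le_mul x2 y1 (norm_nonneg _) hR1)
  have t5 : ‖leftMul y.2 y.1‖ ≤ R * R :=
    (norm_leftMul_le _ _).trans (mul_le_mul y2 y1 (norm_nonneg _) hR0)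
  refine (norm_add_le_of_le (norm_add_le_of_le (norm_sub_le_of_le (norm_sub_le_of_le t1 t2) t3)
    t4) t5)

/-- Under the alternative `Q μ ≠ 0`, the statistic is of the exact order `n`. -/
lemma tendsto_measure_cvm_le (hmuHat : ∀ n s, PathMeasurable ν (muHat n s))
    (hA2 : JointWeakLimit P data muHat μ Qhat Q P₀ w) (h1 : 0 < lowerSqNorm ν (leftMul Q μ))
    (R : ℝ) :
    Tendsto (fun n => P.real {ω | cvm ν n (Qhat n (data n ω)) (muHat n (data n ω)) ≤ R}) atTop
      (𝓝 0) := by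
  refine tendsto_measureReal_zero (WeakConv.tendsto_measure_zero hA2 fun R₀ => ?_)
  have hlarge : Tendsto (fun n : ℕ => (n : ℝ) * (lowerSqNorm ν (leftMul Q μ) / 2)) atTop atTop :=
    tendsto_natCast_atTop_atTop.atTop_mul_const (half_pos h1)
  filter_upwards [eventually_lowerSqNorm_close (ν := ν) (p := p) (q := q) ‖leftMul Q μ‖
    ((‖Q‖ + ‖μ‖) * R₀ + R₀ * R₀) (half_pos h1), eventually_gt_atTop 0,
    hlarge.eventually_gt_atTop R] with n hn hpos hnR ω hω
  by_contra hR₀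
  have hs1 : 1 ≤ Real.sqrt n := Real.one_le_sqrt.2 (Nat.one_le_cast.2 hpos)
  have hs : Real.sqrt n ≠ 0 := by positivity
  set x := Real.sqrt n • (muHat n (data n ω) - μ, Qhat n (data n ω) - Q) with hx
  have hxR : ‖x‖ ≤ R₀ := not_lt.1 hR₀
  have hR1 : 0 ≤ R₀ := (norm_nonneg x).trans hxR
  have t1 : ‖linearPart Q μ x‖ ≤ (‖Q‖ + ‖μ‖) * R₀ :=
    (norm_linearPart_le Q μ x).trans (mul_le_mul_of_nonneg_left hxR (by positivity))
  have t2 : ‖(Real.sqrt n)⁻¹ • leftMul x.2 x.1‖ ≤ R₀ * R₀ := by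
    rw [norm_smul, Real.norm_of_nonneg (inv_nonneg.2 (Real.sqrt_nonneg _))]
    exact (mul_le_of_le_one_left (norm_nonneg _) (inv_le_one_of_one_le₀ hs1)).trans
      ((norm_leftMul_le _ _).trans (mul_le_mul ((norm_snd_le x).trans hxR)
        ((norm_fst_le x).trans hxR) (norm_nonneg _) hR1))
  have hc := hn (leftMul Q μ) _ le_rfl (norm_add_le_of_le t1 t2)
  rw [← leftMul_expansion hs Q _ μ _ hx] at hc
  have hω' : cvm ν n (Qhat n (data n ω)) (muHat n (data n ω)) ≤ R := hω
  rw [cvm_eq (hmuHat n _)] at hω'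
  have hge : lowerSqNorm ν (leftMul Q μ) / 2 ≤
      lowerSqNorm ν (leftMul (Qhat n (data n ω)) (muHat n (data n ω))) := by
    linarith [(abs_le.1 hc).1]
  have := mul_le_mul_of_nonneg_left hge (Nat.cast_nonneg (α := ℝ) n)
  linarith

/-- Level of the test when `Q μ = 0` holds `ν`-almost everywhere. -/
theorem consistentLevel_of_ae_eq_zero (hμ : PathMeasurable ν μ)
    (hmuHat : ∀ n s, PathMeasurable ν (muHat n s))
    (hmuStar : ∀ n s ω', PathMeasurable ν (muStar n s ω'))
    (hQhat : ∀ n s, Qhat n s * Qhat n s = Qhat n s)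
    (hA2 : JointWeakLimit P data muHat μ Qhat Q P₀ w)
    (hA3 : BootstrapWeakLimit P P' data muHat muStar μ Qhat Qstar Q P₀ w P₁ w')
    (h0 : ∀ᵐ u ∂ν, leftMul Q μ u = 0) :
    ConsistentLevel P P' (fun n ω => cvm ν n (Qhat n (data n ω)) (muHat n (data n ω)))
      (fun n ω ω' => cvm ν n (Qstar n (data n ω) ω')
        (constrained (Qhat n (data n ω)) (muHat n (data n ω)) (muStar n (data n ω) ω')))
      P₀ (fun x => limitStat ν Q μ (w x)) := by
  have hT := weakConv_cvm hμ hmuHat hA2 h0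
  have hTs := condWeakConv_cvm hmuHat hmuStar hQhat hA2 hA3.1
  -- both limits are the same function of `(Q w_μ, w_Q μ)`
  have hcont : Continuous fun z : LInf p q × LInf p q => lowerSqNorm ν (z.1 + z.2) :=
    continuous_lowerSqNorm.comp (continuous_fst.add continuous_snd)
  have e1 : (fun x => lowerSqNorm ν (linearPart Q (leftMul (1 - Q) μ) (w' x))) =
      (fun z : LInf p q × LInf p q => lowerSqNorm ν (z.1 + z.2)) ∘
        fun x => projPair Q μ (w' x) := by
    funext x
    refine lowerSqNorm_congr ?_
    filter_upwards [h0] with u hu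
    change Q * (w' x).1 u + (w' x).2 * ((1 - Q) * μ u) = Q * (w' x).1 u + (w' x).2 * μ u
    rw [leftMul_apply] at hu
    rw [Matrix.sub_mul, Matrix.one_mul, hu, sub_zero]
  have e2 : (fun z : LInf p q × LInf p q => lowerSqNorm ν (z.1 + z.2)) ∘
      (fun x => projPair Q μ (w x)) =ᵐ[P₀] fun x => limitStat ν Q μ (w x) := by
    filter_upwards [hA2.ae_pathMeasurable hμ hmuHat] with x hx
    exact (limitStat_eq hμ Q hx).symm
  have hid : IdentDistrib (fun x => lowerSqNorm ν (linearPart Q (leftMul (1 - Q) μ) (w' x)))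
      (fun x => limitStat ν Q μ (w x)) P₁ P₀ := by
    let _ : MeasurableSpace (LInf p q × LInf p q) := borel _
    have : BorelSpace (LInf p q × LInf p q) := ⟨rfl⟩
    rw [e1]
    have h := hA3.2.comp hcont.measurable
    exact h.trans (IdentDistrib.of_ae_eq h.aemeasurable_snd e2)
  have hTs' := hTs.congr_identDistrib hid
  exact ⟨hT, hTs', fun α hα0 hα1 hna =>
    tendsto_rejectProb_null hT hTs' (fun n ω ω' => cvm_nonneg _ _ _) hα0 hα1 hna⟩

/-- Power of the test when `Q μ` does not vanish in `L²(ν)`. -/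
theorem consistentPower_of_pos (hmuHat : ∀ n s, PathMeasurable ν (muHat n s))
    (hmuStar : ∀ n s ω', PathMeasurable ν (muStar n s ω'))
    (hQhat : ∀ n s, Qhat n s * Qhat n s = Qhat n s)
    (hA2 : JointWeakLimit P data muHat μ Qhat Q P₀ w)
    (hA3 : BootstrapWeakLimit P P' data muHat muStar μ Qhat Qstar Q P₀ w P₁ w')
    (h1 : 0 < lowerSqNorm ν (leftMul Q μ)) :
    ConsistentPower P P' (fun n ω => cvm ν n (Qhat n (data n ω)) (muHat n (data n ω)))
      (fun n ω ω' => cvm ν n (Qstar n (data n ω) ω')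
        (constrained (Qhat n (data n ω)) (muHat n (data n ω)) (muStar n (data n ω) ω'))) :=
  fun _ hα0 hα1 => tendsto_rejectProb_one (tendsto_measure_cvm_le hmuHat hA2 h1)
    (condWeakConv_cvm hmuHat hmuStar hQhat hA2 hA3.1) (fun _ _ _ => cvm_nonneg _ _ _) hα0 hα1

end Consistency

/-! ### Gram matrices, projections and the central subspace -/

section Gram

variable {p q : ℕ} {ν : Measure unitInterval}

lemma integrable_entry_mul [IsFiniteMeasure ν] {f g : LInf p q} (hf : PathMeasurable ν f)
    (hg : PathMeasurable ν g) (i k : Fin p) (j : Fin q) :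
    Integrable (fun u => f u i j * g u k j) ν := by
  refine Integrable.of_bound ((hf i j).mul (hg k j)).aestronglyMeasurable (‖f‖ * ‖g‖)
    (Eventually.of_forall fun u => ?_)
  rw [Real.norm_eq_abs, abs_mul]
  exact mul_le_mul (abs_entry_le_norm f u i j) (abs_entry_le_norm g u k j) (abs_nonneg _)
    (norm_nonneg _)

lemma integrable_mul_transpose [IsFiniteMeasure ν] {f g : LInf p q} (hf : PathMeasurable ν f)
    (hg : PathMeasurable ν g) (i k : Fin p) :
    Integrable (fun u => (f u * (g u)ᵀ) i k) ν := by
  simp only [Matrix.mul_apply, Matrix.transpose_apply]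
  exact integrable_finsetSum _ fun j _ => integrable_entry_mul hf hg i k j

lemma mul_gram_apply [IsFiniteMeasure ν] {f : LInf p q} (hf : PathMeasurable ν f)
    (Q : Matrix (Fin p) (Fin p) ℝ) (i k : Fin p) :
    (Q * gram ν f) i k = ∫ u, (leftMul Q f u * (f u)ᵀ) i k ∂ν := by
  simp only [leftMul_apply, Matrix.mul_assoc]
  simp only [Matrix.mul_apply (M := Q), gram]
  rw [integral_finsetSum _ fun j _ => (integrable_mul_transpose hf hf j k).const_mul _]
  simp only [integral_const_mul]

lemma gram_leftMul [IsFiniteMeasure ν] {f : LInf p q} (hf : PathMeasurable ν f)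
    (Q : Matrix (Fin p) (Fin p) ℝ) :
    gram ν (leftMul Q f) = Q * gram ν f * Qᵀ := by
  ext i k
  rw [Matrix.mul_apply]
  simp only [mul_gram_apply hf]
  simp only [← integral_mul_const]
  rw [← integral_finsetSum _ fun j _ =>
    (integrable_mul_transpose (hf.leftMul Q) hf i j).mul_const _]
  refine integral_congr_ae (Eventually.of_forall fun u => ?_)
  change (Q * f u * (Q * f u)ᵀ) i k = ∑ j, (Q * f u * (f u)ᵀ) i j * Qᵀ j k
  rw [Matrix.transpose_mul, ← Matrix.mul_assoc, ← Matrix.mul_apply]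

lemma mul_gram_eq_zero [IsFiniteMeasure ν] {f : LInf p q} (hf : PathMeasurable ν f)
    {Q : Matrix (Fin p) (Fin p) ℝ} (h : ∀ᵐ u ∂ν, leftMul Q f u = 0) : Q * gram ν f = 0 := by
  ext i k
  rw [mul_gram_apply hf, Matrix.zero_apply]
  refine integral_eq_zero_of_ae ?_
  filter_upwards [h] with u hu
  rw [hu, Matrix.zero_mul]
  rfl

/-- The squared Frobenius norm of a matrix `A` is the trace of `A Aᵀ`. -/
lemma lowerSqNorm_eq_trace_gram [IsFiniteMeasure ν] {f : LInf p q} (hf : PathMeasurable ν f) :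
    lowerSqNorm ν f = (gram ν f).trace := by
  rw [lowerSqNorm_eq_integral hf, Matrix.trace]
  simp only [Matrix.diag_apply, gram]
  rw [← integral_finsetSum _ fun i _ => integrable_mul_transpose hf hf i i]
  refine integral_congr_ae (Eventually.of_forall fun u => ?_)
  change ‖f u‖ ^ 2 = ∑ i, (f u * (f u)ᵀ) i i
  rw [frobenius_norm_sq]
  simp only [Matrix.mul_apply, Matrix.transpose_apply, sq]

lemma ae_leftMul_eq_zero_of_mul_gram [IsFiniteMeasure ν] {f : LInf p q} (hf : PathMeasurable ν f)
    {Q : Matrix (Fin p) (Fin p) ℝ} (h : Q * gram ν f = 0) : ∀ᵐ u ∂ν, leftMul Q f u = 0 := by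
  refine ae_eq_zero_of_lowerSqNorm_eq_zero (hf.leftMul Q) ?_
  rw [lowerSqNorm_eq_trace_gram (hf.leftMul Q), gram_leftMul hf, h, Matrix.zero_mul,
    Matrix.trace_zero]

lemma lowerSqNorm_leftMul_pos [IsFiniteMeasure ν] {f : LInf p q} (hf : PathMeasurable ν f)
    {Q : Matrix (Fin p) (Fin p) ℝ} (h : Q * gram ν f ≠ 0) : 0 < lowerSqNorm ν (leftMul Q f) :=
  lt_of_le_of_ne (lowerSqNorm_nonneg _) fun h0 =>
    h (mul_gram_eq_zero hf (ae_eq_zero_of_lowerSqNorm_eq_zero (hf.leftMul Q) h0.symm))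

lemma col_mem_pathSpan (f : LInf p q) (u : unitInterval) (j : Fin q) :
    (fun i => f u i j) ∈ pathSpan f :=
  Submodule.subset_span ⟨u, j, rfl⟩

/-- A projection with kernel the span of the columns of `f` annihilates `f`, hence its Gram
matrix. -/
lemma range_gram_le_pathSpan [IsFiniteMeasure ν] {f : LInf p q} (hf : PathMeasurable ν f) :
    LinearMap.range (gram ν f).mulVecLin ≤ pathSpan f := by
  obtain ⟨C, hC⟩ := Submodule.exists_isCompl (pathSpan f)
  set π : (Fin p → ℝ) →ₗ[ℝ] (Fin p → ℝ) := C.projection (pathSpan f) hC.symm with hπ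
  have hker : LinearMap.ker π = pathSpan f := by rw [hπ, Submodule.ker_projection]
  have hz : LinearMap.toMatrix' π * gram ν f = 0 := by
    refine mul_gram_eq_zero hf (Eventually.of_forall fun u => ?_)
    ext i j
    have h1 : π (fun i => f u i j) = 0 := by
      rw [← LinearMap.mem_ker, hker]; exact col_mem_pathSpan f u j
    rw [← LinearMap.toMatrix'_mulVec] at h1
    exact congrFun h1 i
  rintro _ ⟨v, rfl⟩
  rw [← hker, LinearMap.mem_ker, Matrix.mulVecLin_apply, ← LinearMap.toMatrix'_mulVec,
    Matrix.mulVec_mulVec, hz, Matrix.zero_mulVec]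

lemma ColsOrthogonalTo.leftMul_eq_zero {r : ℕ} {η : Matrix (Fin p) (Fin r) ℝ} {f : LInf p q}
    (h : ColsOrthogonalTo η (pathSpan f)) (u : unitInterval) : leftMul (η * ηᵀ) f u = 0 := by
  have : ηᵀ * f u = 0 := by
    ext k j
    exact h _ (col_mem_pathSpan f u j) k
  rw [leftMul_apply, Matrix.mul_assoc, this, Matrix.mul_zero]

/-- A projection `η ηᵀ` that annihilates `A` has `η` orthogonal to the range of `A`. -/
lemma mul_ne_zero_of_not_colsOrthogonalTo {r : ℕ} {η : Matrix (Fin p) (Fin r) ℝ}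
    {A : Matrix (Fin p) (Fin p) ℝ} (hη : ηᵀ * η = 1)
    (h : ¬ ColsOrthogonalTo η (LinearMap.range A.mulVecLin)) : η * ηᵀ * A ≠ 0 := by
  intro h0
  refine h ?_
  rintro _ ⟨v, rfl⟩ j
  have h1 : ηᵀ * A = 0 := by
    rw [← Matrix.one_mul ηᵀ, ← hη, Matrix.mul_assoc ηᵀ, Matrix.mul_assoc ηᵀ, h0, Matrix.mul_zero]
  change (ηᵀ *ᵥ (A *ᵥ v)) j = 0
  rw [Matrix.mulVec_mulVec, h1, Matrix.zero_mulVec]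
  rfl

lemma mul_transpose_idempotent {r : ℕ} {η : Matrix (Fin p) (Fin r) ℝ} (hη : ηᵀ * η = 1) :
    η * ηᵀ * (η * ηᵀ) = η * ηᵀ := by
  rw [Matrix.mul_assoc, ← Matrix.mul_assoc ηᵀ, hη, Matrix.one_mul]

lemma IsOrthogonalPair.transpose_mul_self {d r : ℕ} {β : Matrix (Fin p) (Fin d) ℝ}
    {η : Matrix (Fin p) (Fin r) ℝ} (h : IsOrthogonalPair β η) : ηᵀ * η = 1 := by
  have h1 := h.1
  rw [Matrix.transpose_fromCols, Matrix.fromRows_mul_fromCols, ← Matrix.fromBlocks_one,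
    Matrix.fromBlocks_inj] at h1
  exact h1.2.2.2

lemma IsLowEigenprojector.idempotent {A Q : Matrix (Fin p) (Fin p) ℝ} {d : ℕ}
    (h : IsLowEigenprojector A d Q) : Q * Q = Q := by
  obtain ⟨U, hU, l, -, -, rfl⟩ := h
  have hU' : Uᵀ * U = 1 := (Matrix.mem_orthogonalGroup_iff' _ _).1 hU
  rw [Matrix.mul_assoc, ← Matrix.mul_assoc Uᵀ, ← Matrix.mul_assoc Uᵀ, hU', Matrix.one_mul,
    ← Matrix.mul_assoc, Matrix.mul_assoc U, Matrix.diagonal_mul_diagonal]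
  congr 3
  ext k
  split_ifs <;> simp

lemma rank_eq_card_of_eq_conj {A U : Matrix (Fin p) (Fin p) ℝ} {l : Fin p → ℝ}
    (hU : U ∈ Matrix.orthogonalGroup (Fin p) ℝ) (hA : A = U * Matrix.diagonal l * Uᵀ) :
    A.rank = Fintype.card {k // l k ≠ 0} := by
  have hU1 : U * Uᵀ = 1 := (Matrix.mem_orthogonalGroup_iff _ _).1 hU
  have hd : U.det * Uᵀ.det = 1 := by rw [← Matrix.det_mul, hU1, Matrix.det_one]
  rw [hA, Matrix.rank_mul_eq_left_of_isUnit_det _ _ (IsUnit.of_mul_eq_one_right _ hd),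
    Matrix.rank_mul_eq_right_of_isUnit_det _ _ (IsUnit.of_mul_eq_one _ hd), Matrix.rank_diagonal]

lemma IsLowEigenprojector.mul_eq {A Q U : Matrix (Fin p) (Fin p) ℝ} {l : Fin p → ℝ} {d : ℕ}
    (hU : U ∈ Matrix.orthogonalGroup (Fin p) ℝ) (hA : A = U * Matrix.diagonal l * Uᵀ)
    (hQ : Q = U * Matrix.diagonal (fun k : Fin p => if d ≤ (k : ℕ) then (1 : ℝ) else 0) * Uᵀ) :
    Q * A = U * Matrix.diagonal (fun k : Fin p => if d ≤ (k : ℕ) then l k else 0) * Uᵀ := by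
  have hU' : Uᵀ * U = 1 := (Matrix.mem_orthogonalGroup_iff' _ _).1 hU
  rw [hA, hQ, Matrix.mul_assoc, ← Matrix.mul_assoc Uᵀ, ← Matrix.mul_assoc Uᵀ, hU', Matrix.one_mul,
    ← Matrix.mul_assoc, Matrix.mul_assoc U, Matrix.diagonal_mul_diagonal]
  congr 3
  ext k
  split_ifs <;> simp

lemma card_le_of_eq_zero {l : Fin p → ℝ} {d : ℕ} (h : ∀ k : Fin p, d ≤ (k : ℕ) → l k = 0) :
    Fintype.card {k // l k ≠ 0} ≤ d := by
  have : Function.Injective fun k : {k // l k ≠ 0} =>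
      (⟨(k.1 : ℕ), not_le.1 fun hd => k.2 (h k.1 hd)⟩ : Fin d) := fun a b hab =>
    Subtype.ext (Fin.ext (Fin.mk.inj hab))
  simpa using Fintype.card_le_of_injective _ this

/-- If `A` has more than `d` nonzero eigenvalues, its low eigenprojector does not annihilate it. -/
lemma IsLowEigenprojector.mul_ne_zero {A Q : Matrix (Fin p) (Fin p) ℝ} {d : ℕ}
    (h : IsLowEigenprojector A d Q) (hd : d < A.rank) : Q * A ≠ 0 := by
  obtain ⟨U, hU, l, -, hA, hQ⟩ := h
  intro h0
  have hU' : Uᵀ * U = 1 := (Matrix.mem_orthogonalGroup_iff' _ _).1 hU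
  rw [IsLowEigenprojector.mul_eq hU hA hQ] at h0
  have h1 : Matrix.diagonal (fun k : Fin p => if d ≤ (k : ℕ) then l k else 0) = 0 := by
    have := congrArg (fun M => Uᵀ * M * U) h0
    simpa only [Matrix.mul_assoc, hU', Matrix.mul_one, Matrix.mul_zero, Matrix.zero_mul,
      ← Matrix.mul_assoc Uᵀ U, Matrix.one_mul] using this
  rw [rank_eq_card_of_eq_conj hU hA] at hd
  refine absurd (card_le_of_eq_zero fun k hk => ?_) (not_le.2 hd)
  have := congrFun (congrFun h1 k) k
  rwa [Matrix.diagonal_apply_eq, if_pos hk] at this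

/-- A Gram matrix of rank at most `d` is annihilated by its low eigenprojector: its eigenvalues are
nonnegative, so a nonzero one beyond the first `d` would come with `d` larger ones. -/
lemma IsLowEigenprojector.mul_gram_eq_zero [IsFiniteMeasure ν] {f : LInf p q}
    (hf : PathMeasurable ν f) {Q : Matrix (Fin p) (Fin p) ℝ} {d : ℕ}
    (h : IsLowEigenprojector (gram ν f) d Q) (hd : (gram ν f).rank ≤ d) : Q * gram ν f = 0 := by
  obtain ⟨U, hU, l, hl, hA, hQ⟩ := h
  have hU' : Uᵀ * U = 1 := (Matrix.mem_orthogonalGroup_iff' _ _).1 hU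
  have hpos : ∀ k, 0 ≤ l k := fun k => by
    have e : gram ν (leftMul Uᵀ f) = Matrix.diagonal l := by
      rw [gram_leftMul hf, hA, Matrix.transpose_transpose]
      simp only [Matrix.mul_assoc, hU', Matrix.mul_one, ← Matrix.mul_assoc Uᵀ U, Matrix.one_mul]
    have e' := congrFun (congrFun e k) k
    rw [Matrix.diagonal_apply_eq] at e'
    rw [← e', gram]
    refine integral_nonneg fun u => ?_
    rw [Pi.zero_apply, Matrix.mul_apply]
    exact Finset.sum_nonneg fun j _ => mul_self_nonneg _
  rw [rank_eq_card_of_eq_conj hU hA] at hd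
  have hz : ∀ k : Fin p, d ≤ (k : ℕ) → l k = 0 := fun k hk => by
    by_contra hne
    have hlk : 0 < l k := lt_of_le_of_ne (hpos k) (Ne.symm hne)
    have hinj : Function.Injective fun i : Fin (d + 1) =>
        (⟨⟨(i : ℕ), by omega⟩, (hlk.trans_le (hl (Fin.le_def.2 (by simp; omega)))).ne'⟩ :
          {k // l k ≠ 0}) := fun a b hab => by
      simpa [Fin.ext_iff] using hab
    have := Fintype.card_le_of_injective _ hinj
    rw [Fintype.card_fin] at this
    omega
  rw [IsLowEigenprojector.mul_eq hU hA hQ]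
  have : (fun k : Fin p => if d ≤ (k : ℕ) then l k else 0) = 0 := by
    funext k
    split_ifs with hk
    · exact hz k hk
    · rfl
  rw [this, Matrix.diagonal_zero', Matrix.mul_zero, Matrix.zero_mul]

end Gram

end InverseRegression

/-! ### Consistency of the three tests -/

theorem mainTheorem5
    {Ω Ω' Ω₀ Ω₁ : Type*} [MeasurableSpace Ω] [MeasurableSpace Ω'] [MeasurableSpace Ω₀]
    [MeasurableSpace Ω₁] (P : Measure Ω) [IsProbabilityMeasure P]
    (P' : Measure Ω') [IsProbabilityMeasure P'] (P₀ : Measure Ω₀) [IsProbabilityMeasure P₀]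
    (P₁ : Measure Ω₁) [IsProbabilityMeasure P₁] {p q : ℕ}
    -- the i.i.d. observations, with invertible variance `S²`
    (X : ℕ → Ω → Fin p → ℝ) (Y : ℕ → Ω → ℝ)
    (hX : ∀ i, Measurable (X i)) (hY : ∀ i, Measurable (Y i))
    (hindep : iIndepFun (fun i ω => (X i ω, Y i ω)) P)
    (hident : ∀ i, IdentDistrib (fun ω => (X i ω, Y i ω)) (fun ω => (X 0 ω, Y 0 ω)) P P)
    (hL2 : ∀ k, MemLp (fun ω => X 0 ω k) 2 P)
    (S : Matrix (Fin p) (Fin p) ℝ) (hS : S.PosDef)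
    (hSsq : S * S = InverseRegression.covMatrix P (X 0))
    -- the central subspace and the standardized central subspace
    (V Ec : Submodule ℝ (Fin p → ℝ)) (hV : InverseRegression.IsCentralSubspace P (X 0) (Y 0) V)
    (hEc : Ec = V.map S.mulVecLin)
    -- the measure, the limit process, its estimator, and the bootstrap version of the latter
    (ν : Measure unitInterval) [IsProbabilityMeasure ν] (μ : InverseRegression.LInf p q)
    (muHat : (n : ℕ) → InverseRegression.Data p n → InverseRegression.LInf p q)
    (muStar : (n : ℕ) → InverseRegression.Data p n → Ω' → InverseRegression.LInf p q)
    (hmuHat : ∀ n s, InverseRegression.PathMeasurable ν (muHat n s))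
    (hmuStar : ∀ n s ω', InverseRegression.PathMeasurable ν (muStar n s ω'))
    -- (A1)
    (hcont : Continuous fun u => μ u) (hspan : InverseRegression.pathSpan μ = Ec) :
    -- test of the dimension
    (∀ (d : ℕ) (Q : Matrix (Fin p) (Fin p) ℝ)
        (Qhat : (n : ℕ) → InverseRegression.Data p n → Matrix (Fin p) (Fin p) ℝ)
        (Qstar : (n : ℕ) → InverseRegression.Data p n → Ω' → Matrix (Fin p) (Fin p) ℝ)
        (w : Ω₀ → InverseRegression.LInf p q × Matrix (Fin p) (Fin p) ℝ)
        (w' : Ω₁ → InverseRegression.LInf p q × Matrix (Fin p) (Fin p) ℝ),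
      InverseRegression.IsLowEigenprojector (InverseRegression.gram ν μ) d Q →
      (∀ n s, InverseRegression.IsLowEigenprojector
        (InverseRegression.gram ν (muHat n s)) d (Qhat n s)) →
      (∀ n s ω', InverseRegression.IsLowEigenprojector
        (InverseRegression.gram ν
          (InverseRegression.constrained (Qhat n s) (muHat n s) (muStar n s ω')))
        d (Qstar n s ω')) →
      -- (A2) and (A3)
      InverseRegression.JointWeakLimit P (InverseRegression.sample P X Y S)
        muHat μ Qhat Q P₀ w →
      InverseRegression.BootstrapWeakLimit P P' (InverseRegression.sample P X Y S)
        muHat muStar μ Qhat Qstar Q P₀ w P₁ w' →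
      (Module.finrank ℝ Ec = d →
        InverseRegression.ConsistentLevel P P'
          (fun n ω => let s := InverseRegression.sample P X Y S n ω
            InverseRegression.cvm ν n (Qhat n s) (muHat n s))
          (fun n ω ω' => let s := InverseRegression.sample P X Y S n ω
            InverseRegression.cvm ν n (Qstar n s ω')
              (InverseRegression.constrained (Qhat n s) (muHat n s) (muStar n s ω')))
          P₀ (fun x => InverseRegression.limitStat ν Q μ (w x))) ∧
      (d < Module.finrank ℝ Ec →
        LinearMap.range (InverseRegression.gram ν μ).mulVecLin = Ec →
        InverseRegression.ConsistentPower P P'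
          (fun n ω => let s := InverseRegression.sample P X Y S n ω
            InverseRegression.cvm ν n (Qhat n s) (muHat n s))
          (fun n ω ω' => let s := InverseRegression.sample P X Y S n ω
            InverseRegression.cvm ν n (Qstar n s ω')
              (InverseRegression.constrained (Qhat n s) (muHat n s) (muStar n s ω'))))) ∧
    -- test of no effect of the predictors `ηᵀ Z`
    (∀ (r : ℕ) (η : Matrix (Fin p) (Fin r) ℝ)
        (w : Ω₀ → InverseRegression.LInf p q × Matrix (Fin p) (Fin p) ℝ)
        (w' : Ω₁ → InverseRegression.LInf p q × Matrix (Fin p) (Fin p) ℝ),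
      ηᵀ * η = 1 →
      -- (A2) and (A3)
      InverseRegression.JointWeakLimit P (InverseRegression.sample P X Y S)
        muHat μ (fun _ _ => η * ηᵀ) (η * ηᵀ) P₀ w →
      InverseRegression.BootstrapWeakLimit P P' (InverseRegression.sample P X Y S)
        muHat muStar μ (fun _ _ => η * ηᵀ) (fun _ _ _ => η * ηᵀ) (η * ηᵀ) P₀ w P₁ w' →
      (InverseRegression.ColsOrthogonalTo η Ec →
        InverseRegression.ConsistentLevel P P'
          (fun n ω => let s := InverseRegression.sample P X Y S n ω
            InverseRegression.cvm ν n (η * ηᵀ) (muHat n s))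
          (fun n ω ω' => let s := InverseRegression.sample P X Y S n ω
            InverseRegression.cvm ν n (η * ηᵀ)
              (InverseRegression.constrained (η * ηᵀ) (muHat n s) (muStar n s ω')))
          P₀ (fun x => InverseRegression.limitStat ν (η * ηᵀ) μ (w x))) ∧
      (¬ InverseRegression.ColsOrthogonalTo η Ec →
        LinearMap.range (InverseRegression.gram ν μ).mulVecLin = Ec →
        InverseRegression.ConsistentPower P P'
          (fun n ω => let s := InverseRegression.sample P X Y S n ω
            InverseRegression.cvm ν n (η * ηᵀ) (muHat n s))
          (fun n ω ω' => let s := InverseRegression.sample P X Y S n ω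
            InverseRegression.cvm ν n (η * ηᵀ)
              (InverseRegression.constrained (η * ηᵀ) (muHat n s) (muStar n s ω'))))) ∧
    -- test of the contribution of a method with estimated basis `betaHat`
    (∀ (d r : ℕ) (β : Matrix (Fin p) (Fin d) ℝ) (η : Matrix (Fin p) (Fin r) ℝ)
        (betaHat : (n : ℕ) → InverseRegression.Data p n → Matrix (Fin p) (Fin d) ℝ)
        (etaHat : (n : ℕ) → InverseRegression.Data p n → Matrix (Fin p) (Fin r) ℝ)
        (Qstar : (n : ℕ) → InverseRegression.Data p n → Ω' → Matrix (Fin p) (Fin p) ℝ)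
        (w : Ω₀ → InverseRegression.LInf p q × Matrix (Fin p) (Fin p) ℝ)
        (w' : Ω₁ → InverseRegression.LInf p q × Matrix (Fin p) (Fin p) ℝ),
      InverseRegression.IsOrthogonalPair β η →
      (∀ n s, InverseRegression.IsOrthogonalPair (betaHat n s) (etaHat n s)) →
      (∀ ε : ℝ, 0 < ε → Tendsto (fun n => P {ω |
        let s := InverseRegression.sample P X Y S n ω
        ε < ‖betaHat n s * (betaHat n s)ᵀ - β * βᵀ‖}) atTop (𝓝 0)) →
      -- (A2) and (A3)
      InverseRegression.JointWeakLimit P (InverseRegression.sample P X Y S)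
        muHat μ (fun n s => etaHat n s * (etaHat n s)ᵀ) (η * ηᵀ) P₀ w →
      InverseRegression.BootstrapWeakLimit P P' (InverseRegression.sample P X Y S)
        muHat muStar μ (fun n s => etaHat n s * (etaHat n s)ᵀ) Qstar (η * ηᵀ) P₀ w P₁ w' →
      (InverseRegression.ColsOrthogonalTo η Ec →
        InverseRegression.ConsistentLevel P P'
          (fun n ω => let s := InverseRegression.sample P X Y S n ω
            InverseRegression.cvm ν n (etaHat n s * (etaHat n s)ᵀ) (muHat n s))
          (fun n ω ω' => let s := InverseRegression.sample P X Y S n ω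
            InverseRegression.cvm ν n (Qstar n s ω')
              (InverseRegression.constrained (etaHat n s * (etaHat n s)ᵀ)
                (muHat n s) (muStar n s ω')))
          P₀ (fun x => InverseRegression.limitStat ν (η * ηᵀ) μ (w x))) ∧
      (¬ InverseRegression.ColsOrthogonalTo η Ec →
        LinearMap.range (InverseRegression.gram ν μ).mulVecLin = Ec →
        InverseRegression.ConsistentPower P P'
          (fun n ω => let s := InverseRegression.sample P X Y S n ω
            InverseRegression.cvm ν n (etaHat n s * (etaHat n s)ᵀ) (muHat n s))
          (fun n ω ω' => let s := InverseRegression.sample P X Y S n ω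
            InverseRegression.cvm ν n (Qstar n s ω')
              (InverseRegression.constrained (etaHat n s * (etaHat n s)ᵀ)
                (muHat n s) (muStar n s ω'))))) := by
  have hμ : InverseRegression.PathMeasurable ν μ := .of_continuous hcont
  refine ⟨?_, ?_, ?_⟩
  · intro d Q Qhat Qstar w w' hQ hQhat _ hA2 hA3
    refine ⟨fun hd => ?_, fun hd hcov => ?_⟩
    · -- without coverage the rank of the Gram matrix may be smaller than `d`
      have hrank : (InverseRegression.gram ν μ).rank ≤ d := by
        rw [← hd, ← hspan]
        exact Submodule.finrank_mono (InverseRegression.range_gram_le_pathSpan hμ)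
      exact InverseRegression.consistentLevel_of_ae_eq_zero hμ hmuHat hmuStar
        (fun n s => (hQhat n s).idempotent) hA2 hA3
        (InverseRegression.ae_leftMul_eq_zero_of_mul_gram hμ (hQ.mul_gram_eq_zero hμ hrank))
    · have hrank : d < (InverseRegression.gram ν μ).rank := by
        rwa [Matrix.rank, hcov]
      exact InverseRegression.consistentPower_of_pos hmuHat hmuStar
        (fun n s => (hQhat n s).idempotent) hA2 hA3
        (InverseRegression.lowerSqNorm_leftMul_pos hμ (hQ.mul_ne_zero hrank))
  · intro r η w w' hη hA2 hA3
    refine ⟨fun h => ?_, fun h hcov => ?_⟩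
    · rw [← hspan] at h
      exact InverseRegression.consistentLevel_of_ae_eq_zero hμ hmuHat hmuStar
        (Qhat := fun _ _ => η * ηᵀ) (Q := η * ηᵀ) (Qstar := fun _ _ _ => η * ηᵀ)
        (fun _ _ => InverseRegression.mul_transpose_idempotent hη) hA2 hA3
        (Eventually.of_forall h.leftMul_eq_zero)
    · rw [← hcov] at h
      exact InverseRegression.consistentPower_of_pos hmuHat hmuStar
        (Qhat := fun _ _ => η * ηᵀ) (Q := η * ηᵀ) (Qstar := fun _ _ _ => η * ηᵀ)
        (fun _ _ => InverseRegression.mul_transpose_idempotent hη) hA2 hA3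
        (InverseRegression.lowerSqNorm_leftMul_pos hμ
          (InverseRegression.mul_ne_zero_of_not_colsOrthogonalTo hη h))
  · intro d r β η betaHat etaHat Qstar w w' hη hetaHat _ hA2 hA3
    refine ⟨fun h => ?_, fun h hcov => ?_⟩
    · rw [← hspan] at h
      exact InverseRegression.consistentLevel_of_ae_eq_zero hμ hmuHat hmuStar
        (Qhat := fun n s => etaHat n s * (etaHat n s)ᵀ) (Q := η * ηᵀ)
        (fun n s => InverseRegression.mul_transpose_idempotent
          (hetaHat n s).transpose_mul_self) hA2 hA3
        (Eventually.of_forall h.leftMul_eq_zero)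
    · rw [← hcov] at h
      exact InverseRegression.consistentPower_of_pos hmuHat hmuStar
        (Qhat := fun n s => etaHat n s * (etaHat n s)ᵀ) (Q := η * ηᵀ)
        (fun n s => InverseRegression.mul_transpose_idempotent
          (hetaHat n s).transpose_mul_self) hA2 hA3
        (InverseRegression.lowerSqNorm_leftMul_pos hμ
          (InverseRegression.mul_ne_zero_of_not_colsOrthogonalTo hη.transpose_mul_self h))
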